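/- Let $C$ be a copula on $[0,1]^m$ (the joint distribution function of a random vector with coordinates uniform on $[0,1]$) having a density $c\ge 0$ with respect to Lebesgue measure on $[0,1]^m$. For $j=1,\dots,m$ let $F_j$ be the distribution function of a probability measure on $\mathbb R$ without singular continuous part, i.e. of the form $f_j(t)\,dt+\nu_j$ with $f_j\ge 0$ measurable and $\nu_j$ carried by a countable set; either part may vanish. Write $F_j(t^-)$ for the left limit, $F_j^{-1}(u)=\inf\{t: u\le F_j(t)\}$ for the quantile function, and $J_j$ for the (countable) set of discontinuities of $F_j$, with counting measure $\delta_{J_j}=\sum_{t\in J_j}\delta_t$. For $x\in\mathbb R^m$ let $\mathcal C(x)=\{j: F_j \text{ is continuous at } x_j\}$, $\mathcal D(x)=\{1,\dots,m\}\setminus\mathcal C(x)$, $b_j=F_j(x_j)$ and $a_j=F_j(x_j^-)$. For a set $S$ of indices with complement $S^c$ let $$c_S(u_S)=\int_{[0,1]^{S^c}}c(u_S,v)\,dv,\qquad c_{S^c|S}(v\mid u_S)=\frac{c(u_S,v)}{c_S(u_S)},\qquad C_{S^c|S}(v\mid u_S)=\int_{[0,1]^{S^c}\cap(-\infty,v]}c_{S^c|S}(w\mid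 u_S)\,dw,$$ and for a function $g$ on $\mathbb R^k$ let $\triangle_{a}^{b}g=\sum_{T\subseteq\{1,\dots,k\}}(-1)^{|T|}g(z^T)$, where $z^T_j=a_j$ for $j\in T$ and $z^T_j=b_j$ for $j\notin T$. Let $U=(U_1,\dots,U_m)$ be a random vector with distribution function $C$, and let $X=(X_1,\dots,X_m)$ be a random vector on the same probability space such that almost surely $U_j=F_j(X_j)$ for all $j\in\mathcal C(X)$ and $X_j=F_j^{-1}(U_j)$ for all $j\in\mathcal D(X)$. Then: (i) $(X,U)$ has the joint density $$f(x,u)=c(u)\prod_{j\in\mathcal C(x)}\mathbf 1\{u_j=F_j(x_j)\}\prod_{j\in\mathcal D(x)}\mathbf 1\{F_j(x_j^-)\le u_j<F_j(x_j)\}$$ with respect to the measure $du\prod_{j}\delta_{F_j^{-1}(u_j)}(dx_j)$, where $du$ is Lebesgue measure on $[0,1]^m$; the same function is also its density with respect to the mixed measure $\prod_{j}\big(f_j(x_j)\,dx_j\,\delta_{F_j(x_j)}(du_j)+\delta_{J_j}(dx_j)\,du_j\big)$. (ii) $X$ has the density $$f(x)=c_{\mathcal C(x)}(b_{\mathcal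 C(x)})\prod_{j\in\mathcal C(x)}f_j(x_j)\;\triangle_{a_{\mathcal D(x)}}^{b_{\mathcal D(x)}}C_{\mathcal D(x)|\mathcal C(x)}(\,\cdot\mid b_{\mathcal C(x)})$$ with respect to the measure $\prod_{j}\big(dx_j+\delta_{J_j}(dx_j)\big)$. (iii) For almost every $x$ with respect to the law of $X$, the conditional distribution of $U_{\mathcal D(x)}$ given $X=x$ has the density $$f(u_{\mathcal D(x)}\mid x)=\frac{c_{\mathcal D(x)|\mathcal C(x)}(u_{\mathcal D(x)}\mid b_{\mathcal C(x)})\prod_{j\in\mathcal D(x)}\mathbf 1\{a_j\le u_j<b_j\}}{\triangle_{a_{\mathcal D(x)}}^{b_{\mathcal D(x)}}C_{\mathcal D(x)|\mathcal C(x)}(\,\cdot\mid b_{\mathcal C(x)})}$$ with respect to Lebesgue measure on $\mathbb R^{\mathcal D(x)}$. -/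

import Mathlib

open MeasureTheory ProbabilityTheory

noncomputable section

namespace MixedCopula

variable {ι : Type*} [Fintype ι] [DecidableEq ι]

/-- A copula, given on all of `ℝ^ι`: the joint distribution function of a random vector whose
coordinates are uniformly distributed on `[0,1]`. -/
def IsCopula (C : (ι → ℝ) → ℝ) : Prop :=
  ∃ κ : Measure (ι → ℝ), IsProbabilityMeasure κ ∧
    (∀ j, κ.map (fun u => u j) = (volume : Measure ℝ).restrict (Set.Icc 0 1)) ∧
    ∀ u, C u = κ.real (Set.Iic u)

/-- `c` is a density of the copula `C` with respect to Lebesgue measure on `[0,1]^ι`. -/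
structure IsCopulaDensity (C c : (ι → ℝ) → ℝ) : Prop where
  measurable : Measurable c
  nonneg : ∀ u, 0 ≤ c u
  eq_integral : ∀ u ∈ Set.Icc (0 : ι → ℝ) 1, C u = ∫ v in Set.Icc 0 u, c v

/-- `μ` has no singular continuous part, and `f` is the density of its absolutely continuous
part: `μ = f(t) dt + ν` with `ν` carried by a countable set. -/
structure IsMixedMarginal (μ : Measure ℝ) (f : ℝ → ℝ) : Prop where
  measurable : Measurable f
  nonneg : ∀ t, 0 ≤ f t
  decomp : ∃ (ν : Measure ℝ) (T : Set ℝ), T.Countable ∧ ν Tᶜ = 0 ∧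
    μ = (volume : Measure ℝ).withDensity (fun t => ENNReal.ofReal (f t)) + ν

/-- The quantile function `F⁻¹(u) = inf {t | u ≤ F(t)}` of the distribution `μ`
(meaningful for `0 < u < 1`). -/
def quantile (μ : Measure ℝ) (u : ℝ) : ℝ := sInf {t : ℝ | u ≤ cdf μ t}

/-- The points at which the distribution function of `μ` jumps. -/
def jumps (μ : Measure ℝ) : Set ℝ := {t | ¬ ContinuousAt (cdf μ) t}

/-- `b_j = F_j(x_j)`. -/
def upper (μ : ι → Measure ℝ) (x : ι → ℝ) : ι → ℝ := fun j => cdf (μ j) (x j)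

/-- `a_j = F_j(x_j⁻)`. -/
def lower (μ : ι → Measure ℝ) (x : ι → ℝ) : ι → ℝ :=
  fun j => Function.leftLim (cdf (μ j)) (x j)

open Classical in
/-- `𝒞(x)`: the indices `j` for which `F_j` is continuous at `x_j`. -/
def contIdx (μ : ι → Measure ℝ) (x : ι → ℝ) : Finset ι :=
  Finset.univ.filter fun j => ContinuousAt (cdf (μ j)) (x j)

/-- `𝒟(x)`: the remaining indices. -/
abbrev discIdx (μ : ι → Measure ℝ) (x : ι → ℝ) : Finset ι := (contIdx μ x)ᶜ

/-- The point of `ℝ^ι` with coordinates `u` on `S` and `v` off `S`. -/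
def glue (S : Finset ι) (u : S → ℝ) (v : ↥Sᶜ → ℝ) : ι → ℝ :=
  fun j => if h : j ∈ S then u ⟨j, h⟩ else v ⟨j, Finset.mem_compl.mpr h⟩

/-- The marginal copula density `c_S(u)`. -/
def margDensity (c : (ι → ℝ) → ℝ) (S : Finset ι) (u : S → ℝ) : ℝ :=
  ∫ v in Set.Icc (0 : ↥Sᶜ → ℝ) 1, c (glue S u v)

/-- The conditional copula density `c_{Sᶜ | S}(v | u)`. -/
def condDensity (c : (ι → ℝ) → ℝ) (S : Finset ι) (v : ↥Sᶜ → ℝ) (u : S → ℝ) : ℝ :=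
  c (glue S u v) / margDensity c S u

/-- The conditional copula distribution function `C_{Sᶜ | S}(v | u)`. -/
def condCopula (c : (ι → ℝ) → ℝ) (S : Finset ι) (v : ↥Sᶜ → ℝ) (u : S → ℝ) : ℝ :=
  ∫ w in Set.Icc (0 : ↥Sᶜ → ℝ) 1 ∩ Set.Iic v, condDensity c S w u

/-- The rectangle difference `Δ_a^b g`, a signed sum over the `2^k` vertices of the box with
corners `a` and `b`; a vertex with coordinate `a_j` exactly for `j ∈ T` has sign `(-1)^|T|`. -/
def rectDiff {κ : Type*} [Fintype κ] [DecidableEq κ] (a b : κ → ℝ) (g : (κ → ℝ) → ℝ) : ℝ :=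
  ∑ T : Finset κ, (-1 : ℝ) ^ T.card * g (fun j => if j ∈ T then a j else b j)

/-- `Δ_{a_𝒟(x)}^{b_𝒟(x)} C_{𝒟(x) | 𝒞(x)}(· | b_𝒞(x))`. -/
def condRectDiff (c : (ι → ℝ) → ℝ) (μ : ι → Measure ℝ) (x : ι → ℝ) : ℝ :=
  rectDiff ((discIdx μ x).restrict (lower μ x)) ((discIdx μ x).restrict (upper μ x))
    fun v => condCopula c (contIdx μ x) v ((contIdx μ x).restrict (upper μ x))

open Classical in
/-- The joint density `f(x,u)`. -/
def jointDensity (c : (ι → ℝ) → ℝ) (μ : ι → Measure ℝ) (x u : ι → ℝ) : ℝ :=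
  c u * (∏ j ∈ contIdx μ x, if u j = upper μ x j then 1 else 0) *
    ∏ j ∈ discIdx μ x, if lower μ x j ≤ u j ∧ u j < upper μ x j then 1 else 0

/-- The likelihood `f(x)`. -/
def likelihood (c : (ι → ℝ) → ℝ) (μ : ι → Measure ℝ) (f : ι → ℝ → ℝ) (x : ι → ℝ) : ℝ :=
  margDensity c (contIdx μ x) ((contIdx μ x).restrict (upper μ x)) *
    (∏ j ∈ contIdx μ x, f j (x j)) * condRectDiff c μ x

open Classical in
/-- The conditional density `f(v | x)` of the latent variables with index in `𝒟(x)`. -/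
def latentDensity (c : (ι → ℝ) → ℝ) (μ : ι → Measure ℝ) (x : ι → ℝ)
    (v : ↥(discIdx μ x) → ℝ) : ℝ :=
  condDensity c (contIdx μ x) v ((contIdx μ x).restrict (upper μ x)) *
      (∏ j : ↥(discIdx μ x), if lower μ x j ≤ v j ∧ v j < upper μ x j then 1 else 0) /
    condRectDiff c μ x

/-- The measure `du ∏_j δ_{F_j⁻¹(u_j)}(dx_j)` in the pair `(x, u)`, with `du` Lebesgue measure
on `[0,1]^ι`. -/
def quantileMeasure (μ : ι → Measure ℝ) : Measure ((ι → ℝ) × (ι → ℝ)) :=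
  ((volume : Measure (ι → ℝ)).restrict (Set.Icc 0 1)).map
    fun u => (fun j => quantile (μ j) (u j), u)

/-- The measure `∏_j (f_j(x_j) dx_j δ_{F_j(x_j)}(du_j) + δ_{J_j}(dx_j) du_j)` in the pair
`(x, u)`, where `δ_{J_j}` is counting measure on the set of jumps of `F_j`. -/
def mixedJointMeasure (μ : ι → Measure ℝ) (f : ι → ℝ → ℝ) : Measure ((ι → ℝ) × (ι → ℝ)) :=
  (Measure.pi fun j =>
      ((volume : Measure ℝ).withDensity fun t => ENNReal.ofReal (f j t)).map
          (fun t => (t, cdf (μ j) t)) +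
        (Measure.count.restrict (jumps (μ j))).prod (volume : Measure ℝ)).map
    fun p => (fun j => (p j).1, fun j => (p j).2)

/-- The measure `∏_j (dx_j + δ_{J_j}(dx_j))`, where `δ_{J_j}` is counting measure on the set of
jumps of `F_j`. -/
def mixedMeasure (μ : ι → Measure ℝ) : Measure (ι → ℝ) :=
  Measure.pi fun j => (volume : Measure ℝ) + Measure.count.restrict (jumps (μ j))

end MixedCopula

end

/-! The hypothesis on `X` and `U` forces `X_j = F_j⁻¹(U_j)` almost surely for every `j`. At a
discontinuity this is assumed. At a continuity point `U_j = F_j(X_j)`, and outside a countable set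
of levels `u` the equation `F_j(t) = u` has no solution other than the quantile. Hence `(X, U)` is
the image of `c(u) du` under `u ↦ (F⁻¹(u), u)` (`map_eq_withDensity_quantileMeasure`), and the
indicators in `jointDensity` equal one almost everywhere for `quantileMeasure`.

As `quantileMeasure` is a product over coordinates, the change of reference measure is a
one-dimensional fact, `IsMixedMarginal.map_quantile_prodMk`: for `u` uniform, the law of `(F⁻¹(u),
u)` is `f(t) dt` carried to the graph of `F`, plus counting measure on the jumps times Lebesgue
measure, cut down to `F(t⁻) ≤ u < F(t)`.

For (ii) and (iii) the difficulty is that the split into continuous and discrete indices depends on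
`x`. It is avoided by giving every coordinate a uniform variable on `[0,1]`, a dummy where `F_j` is
continuous: the joint law is the image, under `(x, u) ↦ (x, latentLevels x u)`, of a measure with
explicit density on the fixed product `mixedMeasure × cubeMeasure`
(`quantileMeasure_withDensity_eq_map`). Tonelli and normalization then give the law of `X` and the
conditional law of `U`. The normalizing integral is that of a slice of `c` over a box, which
inclusion–exclusion (`rectDiff_setIntegral_Iic`) turns into the marginal density times the rectangle
difference.

Since `margDensity` and `condCopula` are Bochner integrals, the slices must be integrable.
`ae_mixedMeasure_integrable_slice` derives this from the independent case, in which the coordinates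
of `x` are quantiles of independent uniforms. -/

noncomputable section

namespace MixedCopula

open scoped ENNReal

/-! ### Product measures and distribution functions on `ℝ^ι`. -/

section Generic

variable {ι : Type*} [Fintype ι] {α : ι → Type*} [∀ i, MeasurableSpace (α i)]

theorem lintegral_pi_prod (μ : ∀ i, Measure (α i)) [∀ i, SigmaFinite (μ i)]
    {f : ∀ i, α i → ℝ≥0∞} (hf : ∀ i, Measurable (f i)) :
    ∫⁻ x, ∏ i, f i (x i) ∂Measure.pi μ = ∏ i, ∫⁻ t, f i t ∂μ i := by
  classical
  have hm : Measurable fun x : ∀ i, α i => ∏ i, f i (x i) :=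
    Finset.measurable_fun_prod _ fun i _ => (hf i).comp (measurable_pi_apply i)
  by_cases hne : Nonempty (∀ i, α i)
  · obtain ⟨x₀⟩ := hne
    -- Tonelli one coordinate at a time: after integrating out `s`, the factors indexed by `sᶜ` are
    -- still unevaluated.
    have key : ∀ (s : Finset ι) (x : ∀ i, α i),
        (∫⋯∫⁻_s, (fun x => ∏ i, f i (x i)) ∂μ) x
          = (∏ i ∈ s, ∫⁻ t, f i t ∂μ i) * ∏ i ∈ sᶜ, f i (x i) := by
      intro s
      induction s using Finset.induction with
      | empty => intro x; simp
      | insert i s hi ih =>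
        intro x
        rw [lmarginal_insert _ hm hi]
        simp only [ih]
        have hs : sᶜ = insert i (insert i s)ᶜ := by
          ext j; by_cases h : j = i <;> simp [h, hi]
        have h2 : ∀ t : α i, ∏ j ∈ sᶜ, f j (Function.update x i t j)
            = f i t * ∏ j ∈ (insert i s)ᶜ, f j (x j) := by
          intro t
          rw [hs, Finset.prod_insert (by simp)]
          congr 1
          · simp
          · refine Finset.prod_congr rfl fun j hj => ?_
            have : j ≠ i := by rintro rfl; simp at hj
            rw [Function.update_of_ne this]
        simp only [h2]
        rw [lintegral_const_mul _ ((hf i).mul_const _), lintegral_mul_const _ (hf i),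
          Finset.prod_insert hi]
        ring
    have := key Finset.univ x₀
    rw [← lintegral_eq_lmarginal_univ] at this
    simpa using this
  · rw [not_nonempty_iff] at hne
    rw [lintegral_of_isEmpty]
    obtain ⟨i, hi⟩ : ∃ i, IsEmpty (α i) := by simpa using hne
    symm
    exact Finset.prod_eq_zero (Finset.mem_univ i) (lintegral_of_isEmpty _ _)

theorem pi_withDensity (μ : ∀ i, Measure (α i)) [∀ i, SigmaFinite (μ i)]
    {f : ∀ i, α i → ℝ≥0∞} (hf : ∀ i, Measurable (f i))
    [∀ i, SigmaFinite ((μ i).withDensity (f i))] :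
    Measure.pi (fun i => (μ i).withDensity (f i))
      = (Measure.pi μ).withDensity fun x => ∏ i, f i (x i) := by
  refine Measure.pi_eq fun s hs => ?_
  rw [withDensity_apply _ (MeasurableSet.univ_pi hs), Measure.restrict_pi_pi, lintegral_pi_prod _ hf]
  exact Finset.prod_congr rfl fun i _ => (withDensity_apply _ (hs i)).symm

/-- Finite measures on `ℝ^ι` are determined by their distribution function. -/
theorem ext_of_Iic_pi (κ κ' : Measure (ι → ℝ)) [IsFiniteMeasure κ]
    (huniv : κ Set.univ = κ' Set.univ) (h : ∀ u, κ (Set.Iic u) = κ' (Set.Iic u)) : κ = κ' := by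
  refine ext_of_generate_finite (Set.pi Set.univ '' Set.pi Set.univ fun _ : ι => Set.range Set.Iic)
    ?_ (IsPiSystem.pi fun _ => isPiSystem_Iic) ?_ huniv
  · refine (generateFrom_eq_pi (fun _ => ?_) fun _ => ?_).symm
    · rw [← borel_eq_generateFrom_Iic]; exact (BorelSpace.measurable_eq).symm
    · refine ⟨fun n : ℕ => Set.Iic (n : ℝ), fun n => ⟨_, rfl⟩, ?_⟩
      refine Set.eq_univ_of_forall fun t => ?_
      obtain ⟨n, hn⟩ := exists_nat_ge t
      exact Set.mem_iUnion.2 ⟨n, hn⟩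
  · rintro _ ⟨s, hs, rfl⟩
    choose u hu using fun i => hs i (Set.mem_univ i)
    obtain rfl : (fun i => Set.Iic (u i)) = s := funext hu
    rw [Set.pi_univ_Iic]
    exact h u

end Generic

/-! ### Marginal and conditional laws of a measure given by a density on a product. -/

section Disintegration

variable {A B B' Ω : Type*} [MeasurableSpace A] [MeasurableSpace B] [MeasurableSpace B']
  [MeasurableSpace Ω]

/-- If `(X, U)` is distributed as the image under `(x, v) ↦ (x, w (x, v))` of the measure with
density `D` with respect to `η × ρ`, then `X` has density `x ↦ ∫ D (x, v) ρ(dv)`. -/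
theorem map_eq_withDensity_lintegral {P : Measure Ω} {X : Ω → A} {U : Ω → B'}
    (hX : Measurable X) (hU : Measurable U) {η : Measure A} [SFinite η] {ρ : Measure B} [SFinite ρ]
    {D : A × B → ℝ≥0∞} (hD : Measurable D) {w : A × B → B'} (hw : Measurable w)
    (hlaw : P.map (fun ω => (X ω, U ω)) = ((η.prod ρ).withDensity D).map fun p => (p.1, w p)) :
    P.map X = η.withDensity fun x => ∫⁻ v, D (x, v) ∂ρ := by
  have h1 : P.map X = (P.map fun ω => (X ω, U ω)).map Prod.fst := by
    rw [Measure.map_map measurable_fst (hX.prodMk hU)]; rfl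
  ext s hs
  rw [h1, hlaw, Measure.map_map measurable_fst (measurable_fst.prodMk hw),
    Measure.map_apply (measurable_fst.comp (measurable_fst.prodMk hw)) hs, withDensity_apply _ hs,
    withDensity_apply _ ((measurable_fst.comp (measurable_fst.prodMk hw)) hs)]
  have : (Prod.fst ∘ fun p : A × B => (p.1, w p)) ⁻¹' s = s ×ˢ Set.univ := by
    ext p; simp
  rw [this, setLIntegral_prod _ hD.aemeasurable]
  simp

/-- In the situation of `map_eq_withDensity_lintegral`, the conditional law of `U` given `X = x`
is the image under `w (x, ·)` of the measure with normalized density `D (x, ·)`. -/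
theorem condDistrib_ae_eq_map_withDensity [StandardBorelSpace B'] [Nonempty B']
    {P : Measure Ω} [IsProbabilityMeasure P] {X : Ω → A} {U : Ω → B'}
    (hX : Measurable X) (hU : Measurable U) {η : Measure A} [SigmaFinite η]
    {ρ : Measure B} [IsFiniteMeasure ρ]
    {D : A × B → ℝ≥0∞} (hD : Measurable D) {w : A × B → B'} (hw : Measurable w)
    (hlaw : P.map (fun ω => (X ω, U ω)) = ((η.prod ρ).withDensity D).map fun p => (p.1, w p)) :
    ∀ᵐ x ∂(P.map X), ∫⁻ v, D (x, v) ∂ρ ≠ 0 ∧ ∫⁻ v, D (x, v) ∂ρ ≠ ∞ ∧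
      condDistrib U X P x =
        (ρ.withDensity fun v => (∫⁻ v, D (x, v) ∂ρ)⁻¹ * D (x, v)).map fun v => w (x, v) := by
  set L : A → ℝ≥0∞ := fun x => ∫⁻ v, D (x, v) ∂ρ with hL
  have hLm : Measurable L := hD.lintegral_prod_right'
  have hPX : P.map X = η.withDensity L := map_eq_withDensity_lintegral hX hU hD hw hlaw
  have hprob : IsProbabilityMeasure (P.map X) := Measure.isProbabilityMeasure_map hX.aemeasurable
  have hLint : ∫⁻ x, L x ∂η ≠ ∞ := by
    have : (P.map X) Set.univ = ∫⁻ x, L x ∂η := by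
      rw [hPX, withDensity_apply _ MeasurableSet.univ, Measure.restrict_univ]
    rw [← this]; simp
  have hLtop : ∀ᵐ x ∂η, L x < ∞ := ae_lt_top hLm hLint
  have hgood : ∀ᵐ x ∂(P.map X), L x ≠ 0 ∧ L x ≠ ∞ := by
    rw [hPX, ae_withDensity_iff hLm]
    filter_upwards [hLtop] with x hx h0 using ⟨h0, hx.ne⟩
  -- The value 0 on the bad set, which is null for the law of `X`, makes `N` a finite kernel at
  -- every `x`, not just at almost every one.
  let G : A → B → ℝ≥0∞ := fun x v => if L x = 0 ∨ L x = ∞ then 0 else (L x)⁻¹ * D (x, v)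
  have hG : Measurable (Function.uncurry G) := by
    refine Measurable.ite ?_ measurable_const ?_
    · exact ((hLm.comp measurable_fst) (measurableSet_singleton 0)).union
        ((hLm.comp measurable_fst) (measurableSet_singleton ∞))
    · exact ((hLm.comp measurable_fst).inv).mul hD
  let N : Kernel A B := Kernel.withDensity (Kernel.const A ρ) G
  have hN : ∀ x, N x = ρ.withDensity (G x) := fun x => by
    simp only [N, Kernel.withDensity_apply _ hG, Kernel.const_apply]
  have : IsFiniteKernel N := by
    refine ⟨⟨1, ENNReal.one_lt_top, fun x => ?_⟩⟩
    rw [hN, withDensity_apply _ MeasurableSet.univ, Measure.restrict_univ]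
    by_cases h : L x = 0 ∨ L x = ∞
    · simp [G, h]
    · simp only [G, h, if_false]
      rw [lintegral_const_mul _
        (show Measurable fun v => D (x, v) from hD.comp measurable_prodMk_left)]
      push Not at h
      exact (ENNReal.inv_mul_cancel h.1 h.2).le
  let κ : Kernel A B' := (Kernel.id ×ₖ N).map w
  have hκ : ∀ x, κ x = (N x).map fun v => w (x, v) := fun x => by
    simp only [κ]
    rw [Kernel.map_apply _ hw, Kernel.prod_apply, Kernel.id_apply, Measure.dirac_prod,
      Measure.map_map hw measurable_prodMk_left]
    rfl
  have hcomp : P.map (fun ω => (X ω, U ω)) = P.map X ⊗ₘ κ := by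
    ext s hs
    have hwm : Measurable fun p : A × B => (p.1, w p) := measurable_fst.prodMk hw
    rw [Measure.compProd_apply hs, hlaw, Measure.map_apply hwm hs, withDensity_apply _ (hwm hs),
      ← lintegral_indicator (hwm hs), lintegral_prod _ (hD.indicator (hwm hs)).aemeasurable, hPX,
      lintegral_withDensity_eq_lintegral_mul _ hLm (Kernel.measurable_kernel_prodMk_left hs)]
    refine lintegral_congr_ae ?_
    filter_upwards [hLtop] with x hx
    have hwx : Measurable fun v => w (x, v) := hw.comp measurable_prodMk_left
    have hsx : MeasurableSet ((fun v => w (x, v)) ⁻¹' (Prod.mk x ⁻¹' s)) :=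
      hwx (measurable_prodMk_left hs)
    rw [Pi.mul_apply, hκ, Measure.map_apply hwx (measurable_prodMk_left hs), hN,
      withDensity_apply _ hsx, ← lintegral_indicator hsx]
    have hDx : Measurable fun v => D (x, v) := hD.comp measurable_prodMk_left
    -- If `L x = 0` then `D (x, ·)` has integral zero and both sides vanish; otherwise the factor `L
    -- x` cancels its inverse.
    by_cases h0 : L x = 0
    · rw [h0, zero_mul]
      refine le_antisymm ?_ zero_le
      calc _ ≤ ∫⁻ v, D (x, v) ∂ρ := lintegral_mono fun v => Set.indicator_le_self _ _ _
        _ = 0 := h0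
    · rw [← lintegral_const_mul' _ _ hx.ne]
      refine lintegral_congr fun v => ?_
      by_cases hv : (x, w (x, v)) ∈ s
      · rw [Set.indicator_of_mem (by exact hv), Set.indicator_of_mem (by exact hv)]
        simp only [G, h0, hx.ne, or_self, if_false]
        rw [← mul_assoc, ENNReal.mul_inv_cancel h0 hx.ne, one_mul]
      · rw [Set.indicator_of_notMem (by exact hv), Set.indicator_of_notMem (by exact hv), mul_zero]
  have huniq := condDistrib_ae_eq_of_measure_eq_compProd X hU.aemeasurable hcomp
  filter_upwards [huniq, hgood] with x hx hgx
  refine ⟨hgx.1, hgx.2, ?_⟩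
  rw [hx, hκ, hN]
  simp only [G, hgx.1, hgx.2, or_self, if_false]
  rfl

end Disintegration

/-! ### Distribution functions, jumps and quantiles on the line. -/

section OneDim

variable (μ : Measure ℝ)

/-- Lebesgue measure on `[0,1]`. -/
abbrev unifMeasure : Measure ℝ := (volume : Measure ℝ).restrict (Set.Icc 0 1)

instance isProbabilityMeasure_unifMeasure : IsProbabilityMeasure unifMeasure :=
  ⟨by simp [unifMeasure]⟩

theorem ae_unifMeasure_Ioo : ∀ᵐ u ∂unifMeasure, u ∈ Set.Ioo (0 : ℝ) 1 := by
  rw [unifMeasure, ← restrict_Ioo_eq_restrict_Icc]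
  exact ae_restrict_mem measurableSet_Ioo

theorem ae_unifMeasure_notMem_of_countable {s : Set ℝ} (hs : s.Countable) :
    ∀ᵐ u ∂unifMeasure, u ∉ s :=
  ae_restrict_of_ae (hs.ae_notMem _)

theorem jumps_countable : (jumps μ).Countable :=
  (monotone_cdf μ).countable_not_continuousAt

theorem measurableSet_jumps : MeasurableSet (jumps μ) := (jumps_countable μ).measurableSet

theorem measurable_cdf : Measurable (cdf μ) := (monotone_cdf μ).measurable

theorem measurable_leftLim_cdf : Measurable (Function.leftLim (cdf μ)) :=
  (monotone_cdf μ).leftLim.measurable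

theorem leftLim_cdf_nonneg (t : ℝ) : 0 ≤ Function.leftLim (cdf μ) t :=
  (cdf_nonneg μ (t - 1)).trans ((monotone_cdf μ).le_leftLim (by linarith))

theorem leftLim_cdf_le (t : ℝ) : Function.leftLim (cdf μ) t ≤ cdf μ t :=
  (monotone_cdf μ).leftLim_le le_rfl

theorem leftLim_cdf_eq_of_notMem_jumps {t : ℝ} (ht : t ∉ jumps μ) :
    Function.leftLim (cdf μ) t = cdf μ t := by
  have hc : ContinuousAt (cdf μ) t := not_not.1 ht
  exact hc.continuousWithinAt.leftLim_eq

theorem mem_jumps_iff_leftLim_lt {t : ℝ} :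
    t ∈ jumps μ ↔ Function.leftLim (cdf μ) t < cdf μ t := by
  constructor
  · intro h
    refine lt_of_le_of_ne (leftLim_cdf_le μ t) fun heq => h ?_
    rw [(monotone_cdf μ).continuousAt_iff_leftLim_eq_rightLim, heq]
    exact ((cdf μ).rightLim_eq t).symm
  · intro h hc
    exact h.ne (leftLim_cdf_eq_of_notMem_jumps μ (not_not.2 hc))

/-! ### The quantile function -/

theorem quantile_le_iff {u : ℝ} (hu : u ∈ Set.Ioo (0 : ℝ) 1) {t : ℝ} :
    quantile μ u ≤ t ↔ u ≤ cdf μ t := by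
  have hbdd : BddBelow {t : ℝ | u ≤ cdf μ t} := by
    have := (tendsto_cdf_atBot μ).eventually (gt_mem_nhds hu.1)
    obtain ⟨s, hs⟩ := this.exists
    refine ⟨s, fun t ht => ?_⟩
    by_contra! h
    exact absurd (ht.trans (monotone_cdf μ h.le)) (not_le.2 hs)
  have hne : {t : ℝ | u ≤ cdf μ t}.Nonempty := by
    have := (tendsto_cdf_atTop μ).eventually (lt_mem_nhds hu.2)
    obtain ⟨s, hs⟩ := this.exists
    exact ⟨s, hs.le⟩
  constructor
  · intro h
    have hr : Filter.Tendsto (cdf μ) (nhdsWithin t (Set.Ioi t)) (nhds (cdf μ t)) :=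
      ((cdf μ).right_continuous t).mono Set.Ioi_subset_Ici_self
    refine ge_of_tendsto hr ?_
    filter_upwards [self_mem_nhdsWithin] with s hs
    obtain ⟨r, hr, hrs⟩ := exists_lt_of_csInf_lt hne (lt_of_le_of_lt h hs)
    exact le_trans hr (monotone_cdf μ hrs.le)
  · intro h
    exact csInf_le hbdd h

theorem le_cdf_quantile {u : ℝ} (hu : u ∈ Set.Ioo (0 : ℝ) 1) : u ≤ cdf μ (quantile μ u) :=
  (quantile_le_iff μ hu).1 le_rfl

theorem leftLim_cdf_quantile_le {u : ℝ} (hu : u ∈ Set.Ioo (0 : ℝ) 1) :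
    Function.leftLim (cdf μ) (quantile μ u) ≤ u := by
  refine le_of_tendsto ((monotone_cdf μ).tendsto_leftLim (quantile μ u)) ?_
  filter_upwards [self_mem_nhdsWithin] with s hs
  by_contra! h
  exact absurd ((quantile_le_iff μ hu).2 h.le) (not_le.2 hs)

theorem quantile_eq_of_mem_Ioo {t u : ℝ} (hu : u ∈ Set.Ioo (Function.leftLim (cdf μ) t) (cdf μ t)) :
    quantile μ u = t := by
  have hu' : u ∈ Set.Ioo (0 : ℝ) 1 :=
    ⟨(leftLim_cdf_nonneg μ t).trans_lt hu.1, hu.2.trans_le (cdf_le_one μ t)⟩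
  refine le_antisymm ((quantile_le_iff μ hu').2 hu.2.le) ?_
  by_contra! h
  have h1 := le_cdf_quantile μ hu'
  have h2 := (monotone_cdf μ).le_leftLim h
  linarith [hu.1]

theorem measurable_quantile : Measurable (quantile μ) := by
  refine measurable_of_Iic fun t => ?_
  -- The Galois connection holds only on `(0,1)`. Elsewhere the quantile is constant: `sInf univ`
  -- for `u ≤ 0` (also when `u = 0`), `sInf ∅` for `u > 1`, and a single value at `u = 1`.
  have : quantile μ ⁻¹' Set.Iic t = (Set.Ioo 0 1 ∩ Set.Iic (cdf μ t)) ∪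
      ((Set.Iic 0 ∩ {_u | sInf (Set.univ : Set ℝ) ≤ t}) ∪
      (({1} ∩ {_u | quantile μ 1 ≤ t}) ∪ (Set.Ioi 1 ∩ {_u | sInf (∅ : Set ℝ) ≤ t}))) := by
    ext u
    rcases le_or_gt u 0 with h0 | h0
    · have : quantile μ u = sInf Set.univ := by
        rw [quantile]; congr 1; ext s; simpa using h0.trans (cdf_nonneg μ s)
      have h1 : u ≤ 1 := h0.trans zero_le_one
      have h2 : u ≠ 1 := by rintro rfl; linarith
      simp [this, h0, not_lt.2 h0, not_lt.2 h1, h2]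
    · rcases lt_trichotomy u 1 with h1 | rfl | h1
      · simp [quantile_le_iff μ ⟨h0, h1⟩, h0, h1, not_le.2 h0, h1.ne, h1.le]
      · simp
      · have : quantile μ u = sInf ∅ := by
          rw [quantile]; congr 1; ext s; simpa using (cdf_le_one μ s).trans_lt h1
        simp [this, h0, h1, not_lt.2 h1.le, not_le.2 h0, h1.ne']
  rw [this]
  refine (measurableSet_Ioo.inter measurableSet_Iic).union
    ((measurableSet_Iic.inter (MeasurableSet.const _)).union
      (((measurableSet_singleton 1).inter (MeasurableSet.const _)).union
        (measurableSet_Ioi.inter (MeasurableSet.const _))))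

theorem map_quantile_unifMeasure [IsProbabilityMeasure μ] : unifMeasure.map (quantile μ) = μ := by
  refine Measure.ext_of_Iic _ _ fun t => ?_
  rw [Measure.map_apply (measurable_quantile μ) measurableSet_Iic, ← ofReal_cdf]
  have : quantile μ ⁻¹' Set.Iic t =ᵐ[unifMeasure] Set.Iic (cdf μ t) := by
    filter_upwards [ae_unifMeasure_Ioo] with u hu
    exact propext (quantile_le_iff μ hu)
  rw [measure_congr this, unifMeasure, Measure.restrict_apply measurableSet_Iic]
  have : Set.Iic (cdf μ t) ∩ Set.Icc 0 1 = Set.Icc 0 (cdf μ t) := by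
    ext u; simp only [Set.mem_inter_iff, Set.mem_Iic, Set.mem_Icc]
    constructor
    · rintro ⟨h, h0, _⟩; exact ⟨h0, h⟩
    · rintro ⟨h0, h⟩; exact ⟨h, h0, h.trans (cdf_le_one μ t)⟩
  rw [this]; simp

/-- The relation between a point `t` and a level `u` that holds for `t = F⁻¹(u)`. -/
def IsMatched (t u : ℝ) : Prop :=
  (t ∉ jumps μ → u = cdf μ t) ∧
    (t ∈ jumps μ → Function.leftLim (cdf μ) t ≤ u ∧ u < cdf μ t)

/-- The quantile always satisfies `F(t⁻) ≤ u ≤ F(t)`. The strict upper inequality at a jump costs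
the countably many levels `F(t)`, `t` a jump. -/
theorem ae_isMatched_quantile : ∀ᵐ u ∂unifMeasure, IsMatched μ (quantile μ u) u := by
  filter_upwards [ae_unifMeasure_Ioo, ae_unifMeasure_notMem_of_countable
    ((jumps_countable μ).image (cdf μ))] with u hu hn
  refine ⟨fun h => le_antisymm (le_cdf_quantile μ hu) ?_, fun h => ⟨leftLim_cdf_quantile_le μ hu, ?_⟩⟩
  · rw [← leftLim_cdf_eq_of_notMem_jumps μ h]; exact leftLim_cdf_quantile_le μ hu
  · exact lt_of_le_of_ne (le_cdf_quantile μ hu) fun h' => hn ⟨_, h, h'.symm⟩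

/-- A second solution `t` of `F(t) = u` makes `F` constant between the quantile and `t`. That
interval contains a rational, so `u` lies in the countable set `F(ℚ)`. -/
theorem ae_eq_quantile_of_eq_cdf :
    ∀ᵐ u ∂unifMeasure, ∀ t, u = cdf μ t → t = quantile μ u := by
  filter_upwards [ae_unifMeasure_Ioo, ae_unifMeasure_notMem_of_countable
    ((Set.countable_range ((↑) : ℚ → ℝ)).image (cdf μ))] with u hu hn t ht
  have h1 : quantile μ u ≤ t := (quantile_le_iff μ hu).2 ht.le
  refine le_antisymm ?_ h1
  by_contra! h
  obtain ⟨q, hq, hqt⟩ := exists_rat_btwn h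
  refine hn ⟨q, ⟨q, rfl⟩, le_antisymm ?_ ?_⟩
  · rw [ht]; exact monotone_cdf μ hqt.le
  · exact (le_cdf_quantile μ hu).trans (monotone_cdf μ hq.le)

/-! ### Marginals without singular continuous part -/

/-- Counting measure on `ℝ` is not σ-finite; its restriction is because the set of jumps is
countable. Products and Tonelli depend on this. -/
instance sigmaFinite_count_restrict_jumps :
    SigmaFinite ((Measure.count : Measure ℝ).restrict (jumps μ)) := by
  have := (jumps_countable μ).to_subtype
  have h : (Measure.count : Measure ℝ).restrict (jumps μ)
      = (Measure.count : Measure (jumps μ)).map (↑) := by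
    ext s hs
    rw [Measure.restrict_apply hs, Measure.map_apply measurable_subtype_coe hs,
      ← Measure.count_injective_image Subtype.val_injective, Subtype.image_preimage_coe,
      Set.inter_comm]
  rw [h]
  exact (MeasurableEmbedding.subtype_coe (measurableSet_jumps μ)).sigmaFinite_map

theorem ae_notMem_jumps : ∀ᵐ t ∂(volume : Measure ℝ), t ∉ jumps μ :=
  (jumps_countable μ).ae_notMem _

theorem ae_mem_jumps : ∀ᵐ t ∂(Measure.count : Measure ℝ).restrict (jumps μ), t ∈ jumps μ :=
  ae_restrict_mem (measurableSet_jumps μ)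

theorem measure_singleton_eq [IsProbabilityMeasure μ] (t : ℝ) :
    μ {t} = ENNReal.ofReal (cdf μ t - Function.leftLim (cdf μ) t) := by
  conv_lhs => rw [← measure_cdf μ]
  exact StieltjesFunction.measure_singleton _ _

variable {μ} {f : ℝ → ℝ}

/-- The jumps are exactly the atoms of `μ`. The Lebesgue part does not charge them, and `ν ≤ μ` is
carried by countably many points, so off the atoms nothing of `ν` is left. -/
theorem IsMixedMarginal.restrict_compl_jumps [IsProbabilityMeasure μ] (h : IsMixedMarginal μ f) :
    μ.restrict (jumps μ)ᶜ = (volume : Measure ℝ).withDensity fun t => ENNReal.ofReal (f t) := by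
  obtain ⟨ν, T, hT, hν, hμ⟩ := h.decomp
  have hac : ((volume : Measure ℝ).withDensity fun t => ENNReal.ofReal (f t)).restrict (jumps μ)ᶜ
      = (volume : Measure ℝ).withDensity fun t => ENNReal.ofReal (f t) := by
    rw [Measure.restrict_eq_self_of_ae_mem]
    exact (withDensity_absolutelyContinuous _ _).ae_le (ae_notMem_jumps μ)
  have hν0 : ν.restrict (jumps μ)ᶜ = 0 := by
    rw [Measure.restrict_eq_zero]
    have h1 : μ (T \ jumps μ) = 0 := by
      rw [← Set.biUnion_of_singleton (T \ jumps μ),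
        measure_biUnion_null_iff (hT.mono Set.sdiff_subset)]
      intro t ht
      rw [measure_singleton_eq, leftLim_cdf_eq_of_notMem_jumps μ ht.2]; simp
    have h2 : ν (T \ jumps μ) = 0 := by
      have hle : ν ≤ μ := hμ.symm ▸ Measure.le_add_left le_rfl
      exact le_antisymm ((hle _).trans h1.le) zero_le
    refine measure_mono_null (t := Tᶜ ∪ (T \ jumps μ)) ?_ (measure_union_null hν h2)
    intro t ht
    by_cases htT : t ∈ T
    · exact Or.inr ⟨htT, ht⟩
    · exact Or.inl htT
  have : μ.restrict (jumps μ)ᶜ = ((volume : Measure ℝ).withDensity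
      fun t => ENNReal.ofReal (f t)).restrict (jumps μ)ᶜ + ν.restrict (jumps μ)ᶜ := by
    rw [← Measure.restrict_add, ← hμ]
  rw [this, hac, hν0, add_zero]

end OneDim

/-! ### The one-dimensional coupling of a point and its level. -/

section Coupling

variable (μ : Measure ℝ) (f : ℝ → ℝ)

/-- The points `(t, u)` with `F(t⁻) ≤ u < F(t)`. -/
def jumpBox : Set (ℝ × ℝ) := {p | Function.leftLim (cdf μ) p.1 ≤ p.2 ∧ p.2 < cdf μ p.1}

theorem measurableSet_jumpBox : MeasurableSet (jumpBox μ) :=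
  (measurableSet_le ((measurable_leftLim_cdf μ).comp measurable_fst) measurable_snd).inter
    (measurableSet_lt measurable_snd ((measurable_cdf μ).comp measurable_fst))

theorem mem_Icc_of_mem_jumpBox {p : ℝ × ℝ} (hp : p ∈ jumpBox μ) : p.2 ∈ Set.Icc (0 : ℝ) 1 :=
  ⟨(leftLim_cdf_nonneg μ _).trans hp.1, hp.2.le.trans (cdf_le_one μ _)⟩

theorem measurableSet_isMatched : MeasurableSet {p : ℝ × ℝ | IsMatched μ p.1 p.2} := by
  have hJ : MeasurableSet {p : ℝ × ℝ | p.1 ∈ jumps μ} := measurable_fst (measurableSet_jumps μ)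
  have : {p : ℝ × ℝ | IsMatched μ p.1 p.2} =
      ({p : ℝ × ℝ | p.1 ∈ jumps μ} ∩ jumpBox μ) ∪
        ({p : ℝ × ℝ | p.1 ∈ jumps μ}ᶜ ∩ {p | p.2 = cdf μ p.1}) := by
    ext p
    by_cases h : p.1 ∈ jumps μ <;> simp [IsMatched, jumpBox, h]
  rw [this]
  exact (hJ.inter (measurableSet_jumpBox μ)).union
    (hJ.compl.inter (measurableSet_eq_fun measurable_snd ((measurable_cdf μ).comp measurable_fst)))

/-- The joint law of `(F⁻¹(u), u)` for `u` uniform on `[0,1]`. -/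
def couplingMeasure : Measure (ℝ × ℝ) :=
  ((volume : Measure ℝ).withDensity fun t => ENNReal.ofReal (f t)).map (fun t => (t, cdf μ t)) +
    (((Measure.count : Measure ℝ).restrict (jumps μ)).prod volume).restrict (jumpBox μ)

theorem ae_prod_mem_jumps (ν : Measure ℝ) [SFinite ν] :
    ∀ᵐ p ∂((Measure.count : Measure ℝ).restrict (jumps μ)).prod ν, p.1 ∈ jumps μ :=
  Measure.quasiMeasurePreserving_fst.ae (ae_mem_jumps μ)

theorem measurable_prodMk_cdf : Measurable fun t => (t, cdf μ t) :=
  measurable_id.prodMk (measurable_cdf μ)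

variable {μ f}

/-- Split according to whether the quantile is a jump. Over a jump `t`, the levels sent to `t` fill
the interval from `F(t⁻)` to `F(t)`, which gives the box part. Off the jumps `u = F(F⁻¹(u))` almost
everywhere and `F⁻¹(u)` has law `μ`, which gives the graph part. -/
theorem IsMixedMarginal.map_quantile_prodMk [IsProbabilityMeasure μ] (h : IsMixedMarginal μ f) :
    unifMeasure.map (fun u => (quantile μ u, u)) = couplingMeasure μ f := by
  ext A hA
  have hQ : Measurable fun u => (quantile μ u, u) := (measurable_quantile μ).prodMk measurable_id
  rw [Measure.map_apply hQ hA, couplingMeasure, Measure.add_apply,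
    Measure.map_apply (measurable_prodMk_cdf μ) hA, Measure.restrict_apply hA, add_comm,
    ← measure_inter_add_sdiff _ (measurable_quantile μ (measurableSet_jumps μ))]
  congr 1
  · have hJc := (jumps_countable μ).to_subtype
    have hU : (fun u => (quantile μ u, u)) ⁻¹' A ∩ quantile μ ⁻¹' jumps μ
        = ⋃ t : jumps μ, {u | quantile μ u = t ∧ ((t : ℝ), u) ∈ A} := by
      ext u
      simp only [Set.mem_inter_iff, Set.mem_preimage, Set.mem_iUnion, Set.mem_ofPred_eq]
      constructor
      · rintro ⟨h1, h2⟩; exact ⟨⟨_, h2⟩, rfl, h1⟩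
      · rintro ⟨t, h1, h2⟩; rw [h1]; exact ⟨h2, t.2⟩
    have hm : ∀ t : jumps μ, MeasurableSet {u | quantile μ u = t ∧ ((t : ℝ), u) ∈ A} := fun t =>
      ((measurable_quantile μ) (measurableSet_singleton _)).inter (measurable_prodMk_left hA)
    rw [hU, measure_iUnion _ hm, Measure.prod_apply (hA.inter (measurableSet_jumpBox μ)),
      lintegral_countable _ (jumps_countable μ)]
    · refine tsum_congr fun t => ?_
      rw [Measure.count_singleton, mul_one]
      have hsub : Prod.mk (t : ℝ) ⁻¹' (A ∩ jumpBox μ) ⊆ Set.Icc 0 1 :=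
        fun u hu => mem_Icc_of_mem_jumpBox μ hu.2
      rw [← Measure.restrict_eq_self _ hsub]
      refine measure_congr ?_
      -- The left endpoint `F(t⁻)` belongs to the box, but its quantile may lie to the left of `t`,
      -- so this one level is discarded.
      filter_upwards [ae_isMatched_quantile μ, ae_unifMeasure_notMem_of_countable
        (Set.countable_singleton (Function.leftLim (cdf μ) t))] with u hu hne
      refine propext ⟨?_, ?_⟩
      · rintro ⟨h1, h2⟩
        rw [h1] at hu
        exact ⟨h2, hu.2 t.2⟩
      · rintro ⟨h1, h2⟩
        exact ⟨quantile_eq_of_mem_Ioo μ ⟨lt_of_le_of_ne h2.1 fun h => hne h.symm, h2.2⟩, h1⟩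
    · intro s t hst
      refine Set.disjoint_left.2 fun u hu hu' => hst (Subtype.ext ?_)
      exact hu.1.symm.trans hu'.1
  · have hB : MeasurableSet ((fun t => (t, cdf μ t)) ⁻¹' A) := measurable_prodMk_cdf μ hA
    rw [← h.restrict_compl_jumps, Measure.restrict_apply hB]
    have hlaw : μ ((fun t => (t, cdf μ t)) ⁻¹' A ∩ (jumps μ)ᶜ) =
        unifMeasure (quantile μ ⁻¹' ((fun t => (t, cdf μ t)) ⁻¹' A ∩ (jumps μ)ᶜ)) := by
      rw [← Measure.map_apply (measurable_quantile μ) (hB.inter (measurableSet_jumps μ).compl),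
        map_quantile_unifMeasure]
    rw [hlaw]
    refine measure_congr ?_
    filter_upwards [ae_isMatched_quantile μ] with u hu
    refine propext ⟨?_, ?_⟩
    · rintro ⟨h1, h2⟩
      refine ⟨?_, h2⟩
      change (quantile μ u, cdf μ (quantile μ u)) ∈ A
      rw [← hu.1 h2]; exact h1
    · rintro ⟨h1, h2⟩
      refine ⟨?_, h2⟩
      change (quantile μ u, cdf μ (quantile μ u)) ∈ A at h1
      rw [← hu.1 h2] at h1; exact h1

/-- In the mixed reference measure the level over a jump ranges over all of `ℝ`. Restricting to
matched pairs, as the indicators in `jointDensity` do, recovers the coupling. -/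
theorem couplingMeasure_eq_restrict :
    couplingMeasure μ f =
      (((volume : Measure ℝ).withDensity fun t => ENNReal.ofReal (f t)).map
          (fun t => (t, cdf μ t)) +
        (Measure.count.restrict (jumps μ)).prod (volume : Measure ℝ)).restrict
          {p | IsMatched μ p.1 p.2} := by
  rw [Measure.restrict_add, couplingMeasure]
  congr 1
  · rw [Measure.restrict_eq_self_of_ae_mem]
    refine (ae_map_iff (measurable_prodMk_cdf μ).aemeasurable (measurableSet_isMatched μ)).2 ?_
    refine (withDensity_absolutelyContinuous _ _).ae_le ?_
    filter_upwards [ae_notMem_jumps μ] with t ht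
    exact ⟨fun _ => rfl, fun h => absurd h ht⟩
  · refine Measure.restrict_congr_set ?_
    filter_upwards [ae_prod_mem_jumps μ volume] with p hp
    refine propext ⟨fun h => ⟨fun h' => absurd hp h', fun _ => h⟩, fun h => h.2 hp⟩

open Classical in
/-- The latent level attached to `t`: the level `F(t)` if `F` is continuous at `t`, and the free
variable `u` otherwise. -/
def latentLevel (μ : Measure ℝ) (t u : ℝ) : ℝ := if t ∈ jumps μ then u else cdf μ t

open Classical in
/-- The density of the coupling of `t` and `u` in the coordinates `(t, latentLevel t u)`. -/
def latentWeight (μ : Measure ℝ) (f : ℝ → ℝ) (t u : ℝ) : ℝ :=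
  if t ∈ jumps μ then (if (t, u) ∈ jumpBox μ then 1 else 0) else f t

theorem measurable_latentLevel (μ : Measure ℝ) :
    Measurable fun p : ℝ × ℝ => latentLevel μ p.1 p.2 :=
  Measurable.ite (measurable_fst (measurableSet_jumps μ)) measurable_snd
    ((measurable_cdf μ).comp measurable_fst)

theorem measurable_latentWeight (μ : Measure ℝ) (hf : Measurable f) :
    Measurable fun p : ℝ × ℝ => latentWeight μ f p.1 p.2 :=
  Measurable.ite (measurable_fst (measurableSet_jumps μ))
    (Measurable.ite (measurableSet_jumpBox μ) measurable_const measurable_const)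
    (hf.comp measurable_fst)

theorem latentWeight_nonneg (hf : ∀ t, 0 ≤ f t) (t u : ℝ) : 0 ≤ latentWeight μ f t u := by
  rw [latentWeight]; split_ifs <;> first | exact zero_le_one | exact le_rfl | exact hf t

/-- The measure `dt + δ_J(dt)` for a single coordinate. -/
abbrev lebCount (μ : Measure ℝ) : Measure ℝ :=
  (volume : Measure ℝ) + Measure.count.restrict (jumps μ)

/-- Off the jumps the uniform variable is a dummy of total mass one and integrates out. At a jump it
is the level itself, and `[0,1]` suffices because it contains every box. -/
theorem couplingMeasure_eq_map_withDensity (hf : Measurable f) :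
    couplingMeasure μ f =
      (((lebCount μ).prod unifMeasure).withDensity
        fun p => ENNReal.ofReal (latentWeight μ f p.1 p.2)).map
          fun p => (p.1, latentLevel μ p.1 p.2) := by
  have hψ : Measurable fun p : ℝ × ℝ => (p.1, latentLevel μ p.1 p.2) :=
    measurable_fst.prodMk (measurable_latentLevel μ)
  rw [lebCount, Measure.add_prod, withDensity_add_measure, Measure.map_add _ _ hψ, couplingMeasure]
  congr 1
  · have h1 : ((volume : Measure ℝ).prod unifMeasure).withDensity
        (fun p => ENNReal.ofReal (latentWeight μ f p.1 p.2))
        = ((volume : Measure ℝ).withDensity fun t => ENNReal.ofReal (f t)).prod unifMeasure := by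
      rw [prod_withDensity_left hf.ennreal_ofReal]
      refine withDensity_congr_ae ?_
      filter_upwards [Measure.quasiMeasurePreserving_fst.ae (ae_notMem_jumps μ)] with p hp
      simp [latentWeight, hp]
    have h2 : ∀ᵐ p ∂((volume : Measure ℝ).withDensity fun t => ENNReal.ofReal (f t)).prod
        unifMeasure, p.1 ∉ jumps μ :=
      Measure.quasiMeasurePreserving_fst.ae
        ((withDensity_absolutelyContinuous _ _).ae_le (ae_notMem_jumps μ))
    have h3 : (fun p : ℝ × ℝ => (p.1, latentLevel μ p.1 p.2)) =ᵐ[((volume : Measure ℝ).withDensity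
        fun t => ENNReal.ofReal (f t)).prod unifMeasure]
        (fun t => (t, cdf μ t)) ∘ Prod.fst := by
      filter_upwards [h2] with p hp
      simp [latentLevel, hp]
    rw [h1, Measure.map_congr h3, ← Measure.map_map (measurable_prodMk_cdf μ) measurable_fst,
      Measure.map_fst_prod]
    simp
  · have h1 : (fun p : ℝ × ℝ => ENNReal.ofReal (latentWeight μ f p.1 p.2))
        =ᵐ[((Measure.count : Measure ℝ).restrict (jumps μ)).prod unifMeasure]
        (jumpBox μ).indicator 1 := by
      filter_upwards [ae_prod_mem_jumps μ unifMeasure] with p hp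
      by_cases hb : p ∈ jumpBox μ <;> simp [latentWeight, hp, hb]
    have h2 : (fun p : ℝ × ℝ => (p.1, latentLevel μ p.1 p.2))
        =ᵐ[(((Measure.count : Measure ℝ).restrict (jumps μ)).prod unifMeasure).restrict
          (jumpBox μ)] id := by
      filter_upwards [ae_restrict_of_ae (ae_prod_mem_jumps μ unifMeasure)] with p hp
      simp [latentLevel, hp]
    rw [withDensity_congr_ae h1, withDensity_indicator_one (measurableSet_jumpBox μ),
      Measure.map_congr h2, Measure.map_id]
    have h3 : ((Measure.count : Measure ℝ).restrict (jumps μ)).prod unifMeasure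
        = (((Measure.count : Measure ℝ).restrict (jumps μ)).prod volume).restrict
          (Set.univ ×ˢ Set.Icc 0 1) := by
      rw [← Measure.prod_restrict, Measure.restrict_univ]
    rw [h3, Measure.restrict_restrict (measurableSet_jumpBox μ), Set.inter_eq_left.2]
    exact fun p hp => ⟨Set.mem_univ _, mem_Icc_of_mem_jumpBox μ hp⟩

open Classical in
-- Serves to carry almost-everywhere statements from `Measure.pi μ` to `mixedMeasure μ`.
theorem IsMixedMarginal.eq_withDensity_lebCount [IsProbabilityMeasure μ]
    (h : IsMixedMarginal μ f) :
    μ = (lebCount μ).withDensity fun t => if t ∈ jumps μ then μ {t} else ENNReal.ofReal (f t) := by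
  rw [lebCount, withDensity_add_measure]
  have h1 : (fun t => if t ∈ jumps μ then μ {t} else ENNReal.ofReal (f t)) =ᵐ[volume]
      fun t => ENNReal.ofReal (f t) := by
    filter_upwards [ae_notMem_jumps μ] with t ht
    simp [ht]
  have h2 : ((Measure.count : Measure ℝ).restrict (jumps μ)).withDensity
      (fun t => if t ∈ jumps μ then μ {t} else ENNReal.ofReal (f t)) = μ.restrict (jumps μ) := by
    ext s hs
    rw [withDensity_apply _ hs, Measure.restrict_restrict hs, Measure.restrict_apply hs,
      lintegral_countable _ ((jumps_countable μ).mono Set.inter_subset_right)]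
    rw [← setLIntegral_one, lintegral_countable _ ((jumps_countable μ).mono Set.inter_subset_right)]
    refine tsum_congr fun t => ?_
    simp [t.2.2]
  rw [withDensity_congr_ae h1, h2, ← h.restrict_compl_jumps, add_comm,
    Measure.restrict_add_restrict_compl (measurableSet_jumps μ)]

end Coupling

/-! ### Copula densities and the joint law of `(X, U)`. -/

section Multivariate

variable {ι : Type*} [Fintype ι]

theorem withDensity_map_eq {α β : Type*} [MeasurableSpace α] [MeasurableSpace β] (ν : Measure α)
    {g : α → β} (hg : Measurable g) {f : β → ℝ≥0∞} (hf : Measurable f) :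
    (ν.map g).withDensity f = (ν.withDensity fun a => f (g a)).map g := by
  ext s hs
  rw [withDensity_apply _ hs, Measure.map_apply hg hs, withDensity_apply _ (hg hs),
    setLIntegral_map hs hf hg]

/-- Lebesgue measure on the unit cube. -/
abbrev cubeMeasure (κ : Type*) [Fintype κ] : Measure (κ → ℝ) :=
  (volume : Measure (κ → ℝ)).restrict (Set.Icc 0 1)

theorem cubeMeasure_eq_pi (κ : Type*) [Fintype κ] :
    cubeMeasure κ = Measure.pi fun _ => unifMeasure := by
  rw [cubeMeasure, ← Set.pi_univ_Icc, volume_pi, Measure.restrict_pi_pi]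
  rfl

instance isProbabilityMeasure_cubeMeasure (κ : Type*) [Fintype κ] :
    IsProbabilityMeasure (cubeMeasure κ) := by
  rw [cubeMeasure_eq_pi]; infer_instance

theorem ae_cubeMeasure_of_forall_ae {p : ι → ℝ → Prop} (h : ∀ j, ∀ᵐ t ∂unifMeasure, p j t) :
    ∀ᵐ u ∂cubeMeasure ι, ∀ j, p j (u j) := by
  rw [cubeMeasure_eq_pi, ae_all_iff]
  exact fun j => (Measure.quasiMeasurePreserving_eval (fun _ : ι => unifMeasure) j).ae (h j)

/-! ### Copula densities -/

theorem IsCopula.ae_mem_Icc {C : (ι → ℝ) → ℝ} (hC : IsCopula C) {κ : Measure (ι → ℝ)}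
    [IsProbabilityMeasure κ] (hκ : ∀ u, κ.real (Set.Iic u) = C u) :
    ∀ᵐ u ∂κ, u ∈ Set.Icc (0 : ι → ℝ) 1 := by
  obtain ⟨κ', hprob, hmarg, hcdf⟩ := hC
  obtain rfl : κ = κ' := ext_of_Iic_pi _ _ (by simp) fun u => by
    rw [← ofReal_measureReal, ← ofReal_measureReal, hκ, hcdf]
  have : ∀ j, ∀ᵐ u ∂κ, u j ∈ Set.Icc (0 : ℝ) 1 := fun j => by
    have h : ∀ᵐ t ∂κ.map (fun u => u j), t ∈ Set.Icc (0 : ℝ) 1 := by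
      rw [hmarg j]; exact ae_restrict_mem measurableSet_Icc
    exact ae_of_ae_map (measurable_pi_apply j).aemeasurable h
  filter_upwards [ae_all_iff.2 this] with u hu
  exact ⟨fun j => (hu j).1, fun j => (hu j).2⟩

theorem IsCopulaDensity.integral_eq_one {C c : (ι → ℝ) → ℝ} (hC : IsCopula C)
    (hc : IsCopulaDensity C c) : ∫ u, c u ∂cubeMeasure ι = 1 := by
  have hC' := hC
  obtain ⟨κ, hprob, -, hcdf⟩ := hC
  have h1 := hc.eq_integral 1 ⟨zero_le_one, le_rfl⟩
  rw [← h1, hcdf, measureReal_def]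
  have : κ (Set.Iic 1) = 1 := by
    rw [prob_compl_eq_zero_iff measurableSet_Iic |>.symm]
    filter_upwards [hC'.ae_mem_Icc fun u => (hcdf u).symm] with u hu
    exact hu.2
  rw [this]; simp

/-- Integrability is not part of `IsCopulaDensity`; it follows because a non-integrable function
would have Bochner integral 0 rather than 1. -/
theorem IsCopulaDensity.integrable {C c : (ι → ℝ) → ℝ} (hC : IsCopula C)
    (hc : IsCopulaDensity C c) : Integrable c (cubeMeasure ι) :=
  integrable_of_integral_eq_one (hc.integral_eq_one hC)

theorem IsCopulaDensity.eq_withDensity {C c : (ι → ℝ) → ℝ} (hC : IsCopula C)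
    (hc : IsCopulaDensity C c) {κ : Measure (ι → ℝ)} [IsProbabilityMeasure κ]
    (hκ : ∀ u, κ.real (Set.Iic u) = C u) :
    κ = (cubeMeasure ι).withDensity fun u => ENNReal.ofReal (c u) := by
  have hint := hc.integrable hC
  have hmem := hC.ae_mem_Icc hκ
  refine ext_of_Iic_pi _ _ ?_ fun u => ?_
  · rw [withDensity_apply _ MeasurableSet.univ, Measure.restrict_univ,
      ← ofReal_integral_eq_lintegral_ofReal hint (Filter.Eventually.of_forall hc.nonneg),
      hc.integral_eq_one hC]
    simp
  · rw [withDensity_apply _ measurableSet_Iic, Measure.restrict_restrict measurableSet_Iic]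
    by_cases hu : 0 ≤ u
    -- The integral formula for `C` is available only inside the cube, so `u` is first truncated at
    -- 1.
    · have h1 : κ (Set.Iic u) = κ (Set.Iic (u ⊓ 1)) := by
        refine measure_congr ?_
        filter_upwards [hmem] with v hv
        exact propext ⟨fun h => le_inf h hv.2, fun h => le_trans h inf_le_left⟩
      have h2 : Set.Iic u ∩ Set.Icc 0 1 = Set.Icc 0 (u ⊓ 1) := by
        ext v
        simp only [Set.mem_inter_iff, Set.mem_Iic, Set.mem_Icc, le_inf_iff]
        tauto
      have h3 : Set.Icc 0 (u ⊓ 1) ⊆ Set.Icc (0 : ι → ℝ) 1 := Set.Icc_subset_Icc_right inf_le_right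
      rw [h1, h2, ← ofReal_measureReal, hκ,
        hc.eq_integral _ ⟨le_inf hu zero_le_one, inf_le_right⟩,
        ofReal_integral_eq_lintegral_ofReal (IntegrableOn.mono_set hint h3)
          (Filter.Eventually.of_forall hc.nonneg)]
    · have h2 : Set.Iic u ∩ Set.Icc 0 1 = ∅ := by
        ext v
        simp only [Set.mem_inter_iff, Set.mem_Iic, Set.mem_Icc, Set.mem_empty_iff_false, iff_false]
        exact fun h => hu (h.2.1.trans h.1)
      rw [h2]
      have : ∀ᵐ v ∂κ, v ∉ Set.Iic u := by
        filter_upwards [hmem] with v hv h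
        exact hu (hv.1.trans h)
      simpa using measure_eq_zero_iff_ae_notMem.2 this

/-! ### The joint law -/

variable (c : (ι → ℝ) → ℝ) (μ : ι → Measure ℝ) (f : ι → ℝ → ℝ)

theorem mem_contIdx {x : ι → ℝ} {j : ι} : j ∈ contIdx μ x ↔ x j ∉ jumps (μ j) := by
  simp [contIdx, jumps]

theorem mem_discIdx [DecidableEq ι] {x : ι → ℝ} {j : ι} :
    j ∈ discIdx μ x ↔ x j ∈ jumps (μ j) := by
  simp [discIdx, mem_contIdx]

theorem jointDensity_eq_indicator [DecidableEq ι] (x u : ι → ℝ) :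
    jointDensity c μ x u =
      {p : (ι → ℝ) × (ι → ℝ) | ∀ j, IsMatched (μ j) (p.1 j) (p.2 j)}.indicator
        (fun p => c p.2) (x, u) := by
  classical
  rw [jointDensity, Finset.prod_ite_zero, Finset.prod_ite_zero]
  simp only [Finset.prod_const_one, mul_assoc]
  have : (x, u) ∈ {p : (ι → ℝ) × (ι → ℝ) | ∀ j, IsMatched (μ j) (p.1 j) (p.2 j)} ↔
      (∀ j ∈ contIdx μ x, u j = upper μ x j) ∧
        ∀ j ∈ discIdx μ x, lower μ x j ≤ u j ∧ u j < upper μ x j := by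
    simp only [mem_contIdx, mem_discIdx, Set.mem_ofPred_eq, IsMatched, lower, upper]
    exact forall_and
  rw [Set.indicator_apply]
  by_cases h1 : ∀ j ∈ contIdx μ x, u j = upper μ x j
  · by_cases h2 : ∀ j ∈ discIdx μ x, lower μ x j ≤ u j ∧ u j < upper μ x j
    · rw [if_pos h1, if_pos h2, if_pos (this.2 ⟨h1, h2⟩)]; simp
    · rw [if_neg h2, if_neg fun h => h2 (this.1 h).2]; simp
  · rw [if_neg h1, if_neg fun h => h1 (this.1 h).1]; simp

theorem measurable_quantile_prodMk {ι : Type*} (μ : ι → Measure ℝ) :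
    Measurable fun u : ι → ℝ => ((fun j => quantile (μ j) (u j) : ι → ℝ), u) :=
  (measurable_pi_lambda _ fun j =>
    (measurable_quantile (μ j)).comp (measurable_pi_apply j)).prodMk measurable_id

theorem measurable_eval_prodMk {ι : Type*} (j : ι) :
    Measurable fun p : (ι → ℝ) × (ι → ℝ) => (p.1 j, p.2 j) :=
  ((measurable_pi_apply j).comp measurable_fst).prodMk
    ((measurable_pi_apply j).comp measurable_snd)

theorem measurableSet_forall_isMatched :
    MeasurableSet {p : (ι → ℝ) × (ι → ℝ) | ∀ j, IsMatched (μ j) (p.1 j) (p.2 j)} := by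
  have : {p : (ι → ℝ) × (ι → ℝ) | ∀ j, IsMatched (μ j) (p.1 j) (p.2 j)} =
      ⋂ j, (fun p : (ι → ℝ) × (ι → ℝ) => (p.1 j, p.2 j)) ⁻¹' {q | IsMatched (μ j) q.1 q.2} := by
    ext p; simp
  rw [this]
  refine MeasurableSet.iInter fun j => ?_
  exact measurable_eval_prodMk j (measurableSet_isMatched (μ j))

theorem ae_isMatched_quantileMeasure :
    ∀ᵐ p ∂quantileMeasure μ, ∀ j, IsMatched (μ j) (p.1 j) (p.2 j) := by
  refine (ae_map_iff (measurable_quantile_prodMk μ).aemeasurable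
    (measurableSet_forall_isMatched μ)).2 ?_
  exact ae_cubeMeasure_of_forall_ae fun j => ae_isMatched_quantile (μ j)

theorem quantileMeasure_withDensity_jointDensity [DecidableEq ι] :
    (quantileMeasure μ).withDensity (fun p => ENNReal.ofReal (jointDensity c μ p.1 p.2)) =
      (quantileMeasure μ).withDensity fun p => ENNReal.ofReal (c p.2) := by
  refine withDensity_congr_ae ?_
  filter_upwards [ae_isMatched_quantileMeasure μ] with p hp
  rw [jointDensity_eq_indicator, Set.indicator_of_mem (by exact hp)]

variable {c μ f}

theorem map_eq_withDensity_quantileMeasure {Ω : Type*} [MeasurableSpace Ω] {P : Measure Ω}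
    {X U : Ω → ι → ℝ} (hU : Measurable U) (hc : Measurable c)
    (hUc : P.map U = (cubeMeasure ι).withDensity fun u => ENNReal.ofReal (c u))
    (hXU : ∀ᵐ ω ∂P, ∀ j, (X ω j ∉ jumps (μ j) → U ω j = cdf (μ j) (X ω j)) ∧
      (X ω j ∈ jumps (μ j) → X ω j = quantile (μ j) (U ω j))) :
    P.map (fun ω => (X ω, U ω)) =
      (quantileMeasure μ).withDensity fun p => ENNReal.ofReal (c p.2) := by
  have h1 : ∀ᵐ u ∂P.map U, ∀ j, ∀ t, u j = cdf (μ j) t → t = quantile (μ j) (u j) := by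
    rw [hUc]
    exact (withDensity_absolutelyContinuous _ _).ae_le
      (ae_cubeMeasure_of_forall_ae fun j => ae_eq_quantile_of_eq_cdf (μ j))
  have h2 : (fun ω => (X ω, U ω)) =ᵐ[P]
      (fun u : ι → ℝ => ((fun j => quantile (μ j) (u j) : ι → ℝ), u)) ∘ U := by
    filter_upwards [ae_of_ae_map hU.aemeasurable h1, hXU] with ω hω hX
    refine Prod.ext (funext fun j => ?_) rfl
    by_cases hj : X ω j ∈ jumps (μ j)
    · exact (hX j).2 hj
    · exact hω j _ ((hX j).1 hj)
  have hc2 : Measurable fun p : (ι → ℝ) × (ι → ℝ) => ENNReal.ofReal (c p.2) :=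
    (hc.comp measurable_snd).ennreal_ofReal
  rw [Measure.map_congr h2, ← Measure.map_map (measurable_quantile_prodMk μ) hU, hUc,
    quantileMeasure, withDensity_map_eq _ (measurable_quantile_prodMk μ) hc2]

variable [∀ j, IsProbabilityMeasure (μ j)]

theorem measurable_unzip {ι : Type*} :
    Measurable fun p : ι → ℝ × ℝ => ((fun j => (p j).1 : ι → ℝ), (fun j => (p j).2 : ι → ℝ)) :=
  (measurable_pi_lambda _ fun j => measurable_fst.comp (measurable_pi_apply j)).prodMk
    (measurable_pi_lambda _ fun j => measurable_snd.comp (measurable_pi_apply j))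

theorem quantileMeasure_eq_map_pi (hμ : ∀ j, IsMixedMarginal (μ j) (f j)) :
    quantileMeasure μ = (Measure.pi fun j => couplingMeasure (μ j) (f j)).map
      fun p => (fun j => (p j).1, fun j => (p j).2) := by
  have hQ : ∀ j, Measurable fun u => (quantile (μ j) u, u) := fun j =>
    (measurable_quantile (μ j)).prodMk measurable_id
  have hprob : ∀ j, IsProbabilityMeasure (unifMeasure.map fun u => (quantile (μ j) u, u)) :=
    fun j => Measure.isProbabilityMeasure_map (hQ j).aemeasurable
  simp_rw [← fun j => (hμ j).map_quantile_prodMk]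
  have hQpi : Measurable fun (u : ι → ℝ) j => (quantile (μ j) (u j), u j) :=
    measurable_pi_lambda _ fun j => (hQ j).comp (measurable_pi_apply j)
  rw [← Measure.pi_map_pi fun j => (hQ j).aemeasurable,
    Measure.map_map measurable_unzip hQpi, ← cubeMeasure_eq_pi]
  rfl

theorem IsMixedMarginal.isFiniteMeasure_withDensity {μ : Measure ℝ} [IsProbabilityMeasure μ]
    {f : ℝ → ℝ} (h : IsMixedMarginal μ f) :
    IsFiniteMeasure ((volume : Measure ℝ).withDensity fun t => ENNReal.ofReal (f t)) := by
  rw [← h.restrict_compl_jumps]; infer_instance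

/-- The indicators restrict the mixed measure to the product of the coordinatewise matched sets. A
restriction to a product set acts coordinate by coordinate, so the one-dimensional identity applies
in each factor. -/
theorem mixedJointMeasure_withDensity_jointDensity [DecidableEq ι]
    (hμ : ∀ j, IsMixedMarginal (μ j) (f j)) :
    (mixedJointMeasure μ f).withDensity
        (fun p => ENNReal.ofReal (jointDensity c μ p.1 p.2)) =
      (quantileMeasure μ).withDensity fun p => ENNReal.ofReal (c p.2) := by
  have hfin := fun j => (hμ j).isFiniteMeasure_withDensity
  have h1 : (fun p : (ι → ℝ) × (ι → ℝ) => ENNReal.ofReal (jointDensity c μ p.1 p.2)) =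
      {p : (ι → ℝ) × (ι → ℝ) | ∀ j, IsMatched (μ j) (p.1 j) (p.2 j)}.indicator
        fun p => ENNReal.ofReal (c p.2) := by
    funext p
    rw [jointDensity_eq_indicator]
    by_cases hp : p ∈ {p : (ι → ℝ) × (ι → ℝ) | ∀ j, IsMatched (μ j) (p.1 j) (p.2 j)}
    · rw [Set.indicator_of_mem hp, Set.indicator_of_mem (by exact hp)]
    · rw [Set.indicator_of_notMem hp, Set.indicator_of_notMem (by exact hp), ENNReal.ofReal_zero]
  rw [h1, withDensity_indicator (measurableSet_forall_isMatched μ)]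
  congr 1
  rw [mixedJointMeasure, Measure.restrict_map measurable_unzip (measurableSet_forall_isMatched μ),
    quantileMeasure_eq_map_pi hμ]
  congr 1
  have h2 : (fun p : ι → ℝ × ℝ => ((fun j => (p j).1 : ι → ℝ), (fun j => (p j).2 : ι → ℝ))) ⁻¹'
      {p : (ι → ℝ) × (ι → ℝ) | ∀ j, IsMatched (μ j) (p.1 j) (p.2 j)} =
      Set.univ.pi fun j => {q | IsMatched (μ j) q.1 q.2} := by
    ext p; simp
  rw [h2, Measure.restrict_pi_pi]
  congr 1
  funext j
  exact couplingMeasure_eq_restrict.symm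

/-! ### Latent levels -/

/-- The vector of latent levels attached to `x`. -/
def latentLevels {ι : Type*} (μ : ι → Measure ℝ) (x u : ι → ℝ) : ι → ℝ :=
  fun j => latentLevel (μ j) (x j) (u j)

theorem measurable_latentLevels {ι : Type*} (μ : ι → Measure ℝ) :
    Measurable fun p : (ι → ℝ) × (ι → ℝ) => latentLevels μ p.1 p.2 :=
  measurable_pi_lambda _ fun j => (measurable_latentLevel (μ j)).comp (measurable_eval_prodMk j)

theorem measurable_prod_latentWeight (μ : ι → Measure ℝ) (hf : ∀ j, Measurable (f j)) :
    Measurable fun p : (ι → ℝ) × (ι → ℝ) =>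
      ∏ j, ENNReal.ofReal (latentWeight (μ j) (f j) (p.1 j) (p.2 j)) :=
  Finset.measurable_fun_prod _ fun j _ =>
    ((measurable_latentWeight (μ j) (hf j)).comp (measurable_eval_prodMk j)).ennreal_ofReal

instance sigmaFinite_mixedMeasure (μ : ι → Measure ℝ) : SigmaFinite (mixedMeasure μ) := by
  unfold mixedMeasure; infer_instance

theorem quantileMeasure_eq_map_withDensity (hμ : ∀ j, IsMixedMarginal (μ j) (f j)) :
    quantileMeasure μ = (((mixedMeasure μ).prod (cubeMeasure ι)).withDensity fun p =>
      ∏ j, ENNReal.ofReal (latentWeight (μ j) (f j) (p.1 j) (p.2 j))).map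
        fun p => (p.1, latentLevels μ p.1 p.2) := by
  have hψ : ∀ j, Measurable fun p : ℝ × ℝ => (p.1, latentLevel (μ j) p.1 p.2) := fun j =>
    measurable_fst.prodMk (measurable_latentLevel (μ j))
  have hk : ∀ j, Measurable fun p : ℝ × ℝ => ENNReal.ofReal (latentWeight (μ j) (f j) p.1 p.2) :=
    fun j => (measurable_latentWeight (μ j) (hμ j).measurable).ennreal_ofReal
  have hΨ : Measurable fun p : (ι → ℝ) × (ι → ℝ) => (p.1, latentLevels μ p.1 p.2) :=
    measurable_fst.prodMk (measurable_latentLevels μ)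
  have hmp := measurePreserving_arrowProdEquivProdArrow ℝ ℝ ι
    (fun j => lebCount (μ j)) (fun _ => unifMeasure)
  have hprod : (mixedMeasure μ).prod (cubeMeasure ι) =
      (Measure.pi fun j => (lebCount (μ j)).prod unifMeasure).map
        fun p => (fun j => (p j).1, fun j => (p j).2) := by
    rw [cubeMeasure_eq_pi, mixedMeasure]
    exact hmp.map_eq.symm
  have hprob : ∀ j, IsProbabilityMeasure ((((lebCount (μ j)).prod unifMeasure).withDensity
      fun p => ENNReal.ofReal (latentWeight (μ j) (f j) p.1 p.2)).map
        fun p => (p.1, latentLevel (μ j) p.1 p.2)) := fun j => by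
    rw [← couplingMeasure_eq_map_withDensity (hμ j).measurable, ← (hμ j).map_quantile_prodMk]
    exact Measure.isProbabilityMeasure_map
      ((measurable_quantile (μ j)).prodMk measurable_id).aemeasurable
  rw [quantileMeasure_eq_map_pi hμ, hprod, withDensity_map_eq _ measurable_unzip
    (measurable_prod_latentWeight μ fun j => (hμ j).measurable), Measure.map_map hΨ measurable_unzip]
  simp_rw [fun j => couplingMeasure_eq_map_withDensity (μ := μ j) (hμ j).measurable]
  have hψpi : Measurable fun (p : ι → ℝ × ℝ) j => ((p j).1, latentLevel (μ j) (p j).1 (p j).2) :=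
    measurable_pi_lambda _ fun j => (hψ j).comp (measurable_pi_apply j)
  rw [← Measure.pi_map_pi fun j => (hψ j).aemeasurable, pi_withDensity _ hk,
    Measure.map_map measurable_unzip hψpi]
  rfl

theorem quantileMeasure_withDensity_eq_map (hc : Measurable c)
    (hμ : ∀ j, IsMixedMarginal (μ j) (f j)) :
    (quantileMeasure μ).withDensity (fun p => ENNReal.ofReal (c p.2)) =
      (((mixedMeasure μ).prod (cubeMeasure ι)).withDensity fun p =>
        (∏ j, ENNReal.ofReal (latentWeight (μ j) (f j) (p.1 j) (p.2 j))) *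
          ENNReal.ofReal (c (latentLevels μ p.1 p.2))).map
        fun p => (p.1, latentLevels μ p.1 p.2) := by
  have hΨ : Measurable fun p : (ι → ℝ) × (ι → ℝ) => (p.1, latentLevels μ p.1 p.2) :=
    measurable_fst.prodMk (measurable_latentLevels μ)
  have hc2 : Measurable fun p : (ι → ℝ) × (ι → ℝ) => ENNReal.ofReal (c p.2) :=
    (hc.comp measurable_snd).ennreal_ofReal
  rw [quantileMeasure_eq_map_withDensity hμ, withDensity_map_eq _ hΨ hc2]
  congr 1
  exact (withDensity_mul _ (measurable_prod_latentWeight μ fun j => (hμ j).measurable)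
    (hc2.comp hΨ)).symm

end Multivariate

/-! ### Rectangle differences as integrals over boxes. -/

section RectDiff

variable {κ : Type*} [Fintype κ]

open Classical in
/-- The indicator of the box `a ≤ v < b`, written as a product. -/
def boxWeight (a b v : κ → ℝ) : ℝ := ∏ j, if a j ≤ v j ∧ v j < b j then 1 else 0

theorem boxWeight_eq_zero {a b v : κ → ℝ} {j : κ} (h : ¬ (a j ≤ v j ∧ v j < b j)) :
    boxWeight a b v = 0 := Finset.prod_eq_zero (Finset.mem_univ j) (if_neg h)

theorem boxWeight_nonneg (a b v : κ → ℝ) : 0 ≤ boxWeight a b v :=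
  Finset.prod_nonneg fun j _ => by split_ifs <;> simp

theorem boxWeight_le_one (a b v : κ → ℝ) : boxWeight a b v ≤ 1 :=
  Finset.prod_le_one (fun j _ => by split_ifs <;> simp) fun j _ => by split_ifs <;> simp

theorem measurable_boxWeight (a b : κ → ℝ) : Measurable (boxWeight a b) := by
  refine Finset.measurable_fun_prod _ fun j _ => Measurable.ite ?_ measurable_const measurable_const
  exact (measurableSet_le measurable_const (measurable_pi_apply j)).inter
    (measurableSet_lt (measurable_pi_apply j) measurable_const)

theorem integrable_mul_boxWeight {g : (κ → ℝ) → ℝ} {ν : Measure (κ → ℝ)} (hg : Integrable g ν)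
    (a b : κ → ℝ) : Integrable (fun w => g w * boxWeight a b w) ν := by
  refine hg.mul_bdd (c := 1) (measurable_boxWeight a b).aestronglyMeasurable
    (Filter.Eventually.of_forall fun w => ?_)
  rw [Real.norm_of_nonneg (boxWeight_nonneg a b w)]
  exact boxWeight_le_one a b w

/-- Inclusion–exclusion: the rectangle difference of an indefinite integral is the integral over
the box. -/
theorem rectDiff_setIntegral_Iic [DecidableEq κ] {a b : κ → ℝ} (hab : a ≤ b) {g : (κ → ℝ) → ℝ}
    (hg : Integrable g (cubeMeasure κ)) :
    rectDiff a b (fun v => ∫ w in Set.Icc (0 : κ → ℝ) 1 ∩ Set.Iic v, g w) =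
      ∫ w, g w * boxWeight a b w ∂cubeMeasure κ := by
  have h1 : ∀ v : κ → ℝ, ∫ w in Set.Icc (0 : κ → ℝ) 1 ∩ Set.Iic v, g w =
      ∫ w, (Set.Iic v).indicator g w ∂cubeMeasure κ := fun v => by
    rw [integral_indicator measurableSet_Iic, Measure.restrict_restrict measurableSet_Iic,
      Set.inter_comm]
  rw [rectDiff]
  simp_rw [h1, ← integral_const_mul]
  rw [← integral_finsetSum _ fun T _ => (hg.indicator measurableSet_Iic).const_mul _]
  refine integral_congr_ae ?_
  -- The box is `a ≤ w < b`, while differences of `Iic` indicators give `a < w ≤ b`; they agree off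
  -- these null hyperplanes.
  have hne : ∀ᵐ w ∂cubeMeasure κ, ∀ j, w j ≠ a j ∧ w j ≠ b j :=
    ae_cubeMeasure_of_forall_ae (p := fun j t => t ≠ a j ∧ t ≠ b j) fun j => by
      filter_upwards [ae_unifMeasure_notMem_of_countable (Set.countable_singleton (a j)),
        ae_unifMeasure_notMem_of_countable (Set.countable_singleton (b j))] with t h1 h2
      exact ⟨h1, h2⟩
  filter_upwards [hne] with w hw
  have h2 : ∀ v : κ → ℝ, (Set.Iic v).indicator g w =
      g w * ∏ j, if w j ≤ v j then (1 : ℝ) else 0 := fun v => by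
    rw [Fintype.prod_ite_zero, Finset.prod_const_one]
    by_cases h : w ≤ v
    · rw [Set.indicator_of_mem (by exact h), if_pos (by exact h), mul_one]
    · rw [Set.indicator_of_notMem (by exact h), if_neg (by exact h), mul_zero]
  have h3 : boxWeight a b w =
      ∏ j, ((if w j ≤ b j then (1 : ℝ) else 0) - if w j ≤ a j then (1 : ℝ) else 0) := by
    refine Finset.prod_congr rfl fun j _ => ?_
    have hj := hab j
    obtain ⟨ha, hb⟩ := hw j
    rcases lt_or_gt_of_ne ha with h | h
    · rw [if_neg fun h' => absurd h'.1 (not_le.2 h), if_pos (h.le.trans hj), if_pos h.le, sub_self]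
    · rcases lt_or_gt_of_ne hb with h' | h'
      · rw [if_pos ⟨h.le, h'⟩, if_pos h'.le, if_neg (not_le.2 h), sub_zero]
      · rw [if_neg fun h'' => absurd h''.2 (not_lt.2 h'.le), if_neg (not_le.2 h'),
          if_neg (not_le.2 h), sub_zero]
  -- Expanding the product of differences yields one signed term per vertex of the box.
  rw [h3, Finset.prod_sub, Finset.mul_sum, Finset.powerset_univ]
  refine Finset.sum_congr rfl fun T _ => ?_
  rw [h2]
  have h4 : (∏ j, if w j ≤ (if j ∈ T then a j else b j) then (1 : ℝ) else 0) =
      (∏ j ∈ Finset.univ \ T, if w j ≤ b j then (1 : ℝ) else 0) *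
        ∏ j ∈ T, if w j ≤ a j then (1 : ℝ) else 0 := by
    rw [← Finset.prod_sdiff (Finset.subset_univ T)]
    congr 1
    · exact Finset.prod_congr rfl fun j hj => by rw [if_neg (Finset.mem_sdiff.1 hj).2]
    · exact Finset.prod_congr rfl fun j hj => by rw [if_pos hj]
  rw [h4]
  ring

end RectDiff

/-! ### Slices of the copula density and their integrability. -/

section Slices

variable {ι : Type*} [Fintype ι] [DecidableEq ι]

theorem map_restrict_cubeMeasure {ι : Type*} [Fintype ι] (T : Finset ι) :
    (cubeMeasure ι).map T.restrict = cubeMeasure T := by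
  rw [cubeMeasure_eq_pi, cubeMeasure_eq_pi, ← Measure.infinitePi_eq_pi,
    Measure.infinitePi_map_restrict]

theorem measurable_glue (S : Finset ι) (u : S → ℝ) : Measurable (glue S u) := by
  refine measurable_pi_lambda _ fun j => ?_
  by_cases h : j ∈ S
  · simp only [glue, h, dif_pos]; exact measurable_const
  · simp only [glue, h, dif_neg, not_false_eq_true]; exact measurable_pi_apply _

theorem margDensity_mul_rectDiff_condCopula {c : (ι → ℝ) → ℝ} (hc0 : ∀ u, 0 ≤ c u)
    (S : Finset ι) (u : S → ℝ) {a b : ↥Sᶜ → ℝ} (hab : a ≤ b)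
    (hint : Integrable (fun v => c (glue S u v)) (cubeMeasure ↥Sᶜ)) :
    margDensity c S u * rectDiff a b (fun v => condCopula c S v u) =
      ∫ v, c (glue S u v) * boxWeight a b v ∂cubeMeasure ↥Sᶜ := by
  have h : rectDiff a b (fun v => condCopula c S v u) =
      ∫ v, c (glue S u v) / margDensity c S u * boxWeight a b v ∂cubeMeasure ↥Sᶜ :=
    rectDiff_setIntegral_Iic hab (hint.div_const _)
  rw [h, ← integral_const_mul]
  -- When the marginal density is zero, `condDensity` is zero by the convention for division; the
  -- nonnegative slice then vanishes almost everywhere, so the identity persists.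
  by_cases hm : margDensity c S u = 0
  · have h0 : (fun v => c (glue S u v)) =ᵐ[cubeMeasure ↥Sᶜ] 0 :=
      (integral_eq_zero_iff_of_nonneg (fun v => hc0 _) hint).1 hm
    refine integral_congr_ae ?_
    filter_upwards [h0] with v hv
    simp only [Pi.zero_apply] at hv
    simp [hv]
  · refine integral_congr_ae (Filter.Eventually.of_forall fun v => ?_)
    simp only
    field_simp

/-- Almost every slice of an integrable function on the cube is integrable. -/
theorem ae_lintegral_mix_lt_top {c : (ι → ℝ) → ℝ≥0∞} (hc : Measurable c)
    (hint : ∫⁻ u, c u ∂cubeMeasure ι ≠ ∞) (S : Finset ι) :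
    ∀ᵐ u ∂cubeMeasure ι, ∫⁻ v, c (fun j => if j ∈ S then u j else v j) ∂cubeMeasure ι < ∞ := by
  have hmix : Measurable fun p : (ι → ℝ) × (ι → ℝ) => (fun j => if j ∈ S then p.1 j else p.2 j) := by
    refine measurable_pi_lambda _ fun j => ?_
    by_cases h : j ∈ S
    · simp only [h, if_true]; exact (measurable_pi_apply j).comp measurable_fst
    · simp only [h, if_false]; exact (measurable_pi_apply j).comp measurable_snd
  have hg : ∀ j, Measurable fun p : ℝ × ℝ => if j ∈ S then p.1 else p.2 := fun j => by
    by_cases h : j ∈ S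
    · simp only [h, if_true]; exact measurable_fst
    · simp only [h, if_false]; exact measurable_snd
  have hgmap : ∀ j, (unifMeasure.prod unifMeasure).map (fun p => if j ∈ S then p.1 else p.2) =
      unifMeasure := fun j => by
    by_cases h : j ∈ S
    · simp only [h, if_true]
      exact measurePreserving_fst.map_eq
    · simp only [h, if_false]
      exact measurePreserving_snd.map_eq
  have hprod : (cubeMeasure ι).prod (cubeMeasure ι) =
      (Measure.pi fun _ : ι => unifMeasure.prod unifMeasure).map
        fun p => (fun j => (p j).1, fun j => (p j).2) := by
    rw [cubeMeasure_eq_pi]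
    exact (measurePreserving_arrowProdEquivProdArrow ℝ ℝ ι
      (fun _ => unifMeasure) (fun _ => unifMeasure)).map_eq.symm
  have hprob : ∀ j, IsProbabilityMeasure ((unifMeasure.prod unifMeasure).map
      (fun p => if j ∈ S then p.1 else p.2)) := fun j => by rw [hgmap]; infer_instance
  -- Selecting each coordinate from one of two independent uniform vectors gives a uniform vector
  -- again, so the double integral of the mixed function is the integral of `c`.
  have hmp : ((cubeMeasure ι).prod (cubeMeasure ι)).map
      (fun p : (ι → ℝ) × (ι → ℝ) => (fun j => if j ∈ S then p.1 j else p.2 j)) =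
      cubeMeasure ι := by
    have := Measure.pi_map_pi (μ := fun _ : ι => unifMeasure.prod unifMeasure)
      fun j => (hg j).aemeasurable
    simp_rw [hgmap] at this
    rw [hprod, Measure.map_map hmix measurable_unzip, cubeMeasure_eq_pi, ← this]
    rfl
  have hcm : Measurable fun p : (ι → ℝ) × (ι → ℝ) => c fun j => if j ∈ S then p.1 j else p.2 j :=
    hc.comp hmix
  have h := lintegral_map hc hmix (μ := (cubeMeasure ι).prod (cubeMeasure ι))
  rw [hmp, lintegral_prod _ hcm.aemeasurable] at h
  refine ae_lt_top hcm.lintegral_prod_right' ?_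
  exact h ▸ hint

end Slices

/-! ### Evaluation of the normalizing integral and of the conditional density. -/

section Likelihood

variable {ι : Type*} [Fintype ι] [DecidableEq ι] {c : (ι → ℝ) → ℝ} {μ : ι → Measure ℝ}
  {f : ι → ℝ → ℝ}

theorem latentLevels_eq_glue (x u : ι → ℝ) :
    latentLevels μ x u =
      glue (contIdx μ x) ((contIdx μ x).restrict (upper μ x)) ((discIdx μ x).restrict u) := by
  funext j
  by_cases h : x j ∈ jumps (μ j)
  · have h' : j ∉ contIdx μ x := by rw [mem_contIdx]; exact not_not.2 h
    simp [latentLevels, latentLevel, glue, h, h']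
  · have h' : j ∈ contIdx μ x := by rwa [mem_contIdx]
    simp [latentLevels, latentLevel, glue, h, h', upper]

theorem restrict_latentLevels (x u : ι → ℝ) :
    (discIdx μ x).restrict (latentLevels μ x u) = (discIdx μ x).restrict u := by
  funext j
  have : x j ∈ jumps (μ j) := (mem_discIdx μ).1 j.2
  simp [latentLevels, latentLevel, this]

theorem prod_latentWeight (x u : ι → ℝ) :
    ∏ j, latentWeight (μ j) (f j) (x j) (u j) =
      (∏ j ∈ contIdx μ x, f j (x j)) *
        boxWeight ((discIdx μ x).restrict (lower μ x)) ((discIdx μ x).restrict (upper μ x))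
          ((discIdx μ x).restrict u) := by
  classical
  rw [← Finset.prod_mul_prod_compl (contIdx μ x)]
  congr 1
  · refine Finset.prod_congr rfl fun j hj => ?_
    rw [latentWeight, if_neg ((mem_contIdx μ).1 hj)]
  · rw [boxWeight, ← Finset.prod_coe_sort]
    refine Finset.prod_congr rfl fun j _ => ?_
    rw [latentWeight, if_pos ((mem_discIdx μ).1 j.2)]
    exact if_congr Iff.rfl rfl rfl

/-- The density of the copula on the slice determined by the continuous coordinates of `x`. -/
def slice (c : (ι → ℝ) → ℝ) (μ : ι → Measure ℝ) (x : ι → ℝ) (v : ↥(discIdx μ x) → ℝ) : ℝ :=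
  c (glue (contIdx μ x) ((contIdx μ x).restrict (upper μ x)) v)

/-- The indicator of the box `a_j ≤ v_j < b_j`, `j ∈ 𝒟(x)`. -/
abbrev sliceBox (μ : ι → Measure ℝ) (x : ι → ℝ) (v : ↥(discIdx μ x) → ℝ) : ℝ :=
  boxWeight ((discIdx μ x).restrict (lower μ x)) ((discIdx μ x).restrict (upper μ x)) v

theorem measurable_slice (hc : Measurable c) (x : ι → ℝ) : Measurable (slice c μ x) :=
  hc.comp (measurable_glue _ _)

theorem prod_latentWeight_mul (hf : ∀ j t, 0 ≤ f j t) (hc0 : ∀ u, 0 ≤ c u) (x u : ι → ℝ) :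
    (∏ j, ENNReal.ofReal (latentWeight (μ j) (f j) (x j) (u j))) *
        ENNReal.ofReal (c (latentLevels μ x u)) =
      ENNReal.ofReal (∏ j ∈ contIdx μ x, f j (x j)) *
        ENNReal.ofReal (slice c μ x ((discIdx μ x).restrict u) *
          sliceBox μ x ((discIdx μ x).restrict u)) := by
  have hs : 0 ≤ slice c μ x ((discIdx μ x).restrict u) := hc0 _
  rw [← ENNReal.ofReal_prod_of_nonneg fun j _ => latentWeight_nonneg (hf j) _ _,
    prod_latentWeight, latentLevels_eq_glue,
    ENNReal.ofReal_mul (Finset.prod_nonneg fun j _ => hf j _), ENNReal.ofReal_mul hs,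
    mul_assoc, mul_comm (ENNReal.ofReal (boxWeight _ _ _))]
  rfl

theorem lintegral_comp_restrict {ι : Type*} [Fintype ι] (T : Finset ι)
    {g : (T → ℝ) → ℝ≥0∞} (hg : Measurable g) :
    ∫⁻ u, g (T.restrict u) ∂cubeMeasure ι = ∫⁻ v, g v ∂cubeMeasure T := by
  rw [← map_restrict_cubeMeasure, lintegral_map hg (Finset.measurable_restrict T)]

theorem integrable_slice (hc : Measurable c) (hc0 : ∀ u, 0 ≤ c u) {x : ι → ℝ}
    (hx : ∫⁻ u, ENNReal.ofReal (c (latentLevels μ x u)) ∂cubeMeasure ι < ∞) :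
    Integrable (slice c μ x) (cubeMeasure ↥(discIdx μ x)) := by
  have h : ∫⁻ u, ENNReal.ofReal (c (latentLevels μ x u)) ∂cubeMeasure ι =
      ∫⁻ v, ENNReal.ofReal (slice c μ x v) ∂cubeMeasure ↥(discIdx μ x) := by
    rw [← lintegral_comp_restrict _ (measurable_slice hc x).ennreal_ofReal]
    simp_rw [latentLevels_eq_glue]
    rfl
  have hs : ∀ v, 0 ≤ slice c μ x v := fun v => hc0 _
  refine ⟨(measurable_slice hc x).aestronglyMeasurable, ?_⟩
  rw [hasFiniteIntegral_iff_ofReal (Filter.Eventually.of_forall hs), ← h]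
  exact hx

theorem margDensity_mul_condRectDiff (hc0 : ∀ u, 0 ≤ c u) {x : ι → ℝ}
    (hx : Integrable (slice c μ x) (cubeMeasure ↥(discIdx μ x))) :
    margDensity c (contIdx μ x) ((contIdx μ x).restrict (upper μ x)) * condRectDiff c μ x =
      ∫ v, slice c μ x v * sliceBox μ x v ∂cubeMeasure ↥(discIdx μ x) :=
  margDensity_mul_rectDiff_condCopula hc0 _ _ (fun _ => leftLim_cdf_le _ _) hx

theorem lintegral_eq_mul_margDensity (hc : Measurable c) (hc0 : ∀ u, 0 ≤ c u)
    (hf : ∀ j t, 0 ≤ f j t) {x : ι → ℝ}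
    (hx : Integrable (slice c μ x) (cubeMeasure ↥(discIdx μ x))) :
    ∫⁻ u, (∏ j, ENNReal.ofReal (latentWeight (μ j) (f j) (x j) (u j))) *
        ENNReal.ofReal (c (latentLevels μ x u)) ∂cubeMeasure ι =
      ENNReal.ofReal (∏ j ∈ contIdx μ x, f j (x j)) *
        ENNReal.ofReal (margDensity c (contIdx μ x) ((contIdx μ x).restrict (upper μ x)) *
          condRectDiff c μ x) := by
  simp_rw [prod_latentWeight_mul hf hc0]
  have hm : Measurable fun v => ENNReal.ofReal (slice c μ x v * sliceBox μ x v) :=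
    ((measurable_slice hc x).mul (measurable_boxWeight _ _)).ennreal_ofReal
  rw [lintegral_const_mul' _ _ ENNReal.ofReal_ne_top, lintegral_comp_restrict _ hm,
    margDensity_mul_condRectDiff hc0 hx, ofReal_integral_eq_lintegral_ofReal
      (integrable_mul_boxWeight hx _ _)
      (Filter.Eventually.of_forall fun v => mul_nonneg (hc0 _) (boxWeight_nonneg _ _ _))]

theorem latentDensity_eq (x : ι → ℝ) (v : ↥(discIdx μ x) → ℝ) :
    latentDensity c μ x v = slice c μ x v * sliceBox μ x v /
      (margDensity c (contIdx μ x) ((contIdx μ x).restrict (upper μ x)) * condRectDiff c μ x) := by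
  have : latentDensity c μ x v = slice c μ x v /
      margDensity c (contIdx μ x) ((contIdx μ x).restrict (upper μ x)) * sliceBox μ x v /
        condRectDiff c μ x := rfl
  rw [this, ← div_div]
  ring

/-- The levels `F(t⁻)` and `F(t)` lie in `[0,1]`, so the box indicator already kills the density
outside the cube. -/
theorem volume_withDensity_latentDensity (x : ι → ℝ) :
    (volume : Measure (↥(discIdx μ x) → ℝ)).withDensity
        (fun v => ENNReal.ofReal (latentDensity c μ x v)) =
      (cubeMeasure ↥(discIdx μ x)).withDensity
        fun v => ENNReal.ofReal (latentDensity c μ x v) := by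
  rw [cubeMeasure, ← withDensity_indicator measurableSet_Icc]
  congr 1
  funext v
  by_cases hv : v ∈ Set.Icc 0 1
  · rw [Set.indicator_of_mem hv]
  · rw [Set.indicator_of_notMem hv, latentDensity_eq]
    obtain ⟨j, hj⟩ : ∃ j : ↥(discIdx μ x), ¬ (lower μ x j ≤ v j ∧ v j < upper μ x j) := by
      by_contra! h
      exact hv ⟨fun j => (leftLim_cdf_nonneg _ _).trans (h j).1,
        fun j => (h j).2.le.trans (cdf_le_one _ _)⟩
    rw [sliceBox, boxWeight_eq_zero (j := j) hj]
    simp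

theorem map_restrict_withDensity_eq (hc : Measurable c) (hc0 : ∀ u, 0 ≤ c u)
    (hf : ∀ j t, 0 ≤ f j t) {x : ι → ℝ}
    (hx : Integrable (slice c μ x) (cubeMeasure ↥(discIdx μ x)))
    {L : ℝ≥0∞} (hL : L = ∫⁻ u, (∏ j, ENNReal.ofReal (latentWeight (μ j) (f j) (x j) (u j))) *
        ENNReal.ofReal (c (latentLevels μ x u)) ∂cubeMeasure ι) (hL0 : L ≠ 0) :
    (((cubeMeasure ι).withDensity fun u => L⁻¹ *
        ((∏ j, ENNReal.ofReal (latentWeight (μ j) (f j) (x j) (u j))) *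
          ENNReal.ofReal (c (latentLevels μ x u)))).map fun u => latentLevels μ x u).map
        (discIdx μ x).restrict =
      (volume : Measure (↥(discIdx μ x) → ℝ)).withDensity
        fun v => ENNReal.ofReal (latentDensity c μ x v) := by
  have hw : Measurable fun u => latentLevels μ x u :=
    (measurable_latentLevels μ).comp measurable_prodMk_left
  have hr := Finset.measurable_restrict (X := fun _ : ι => ℝ) (discIdx μ x)
  have hcomp : (discIdx μ x).restrict ∘ (fun u => latentLevels μ x u) =
      (discIdx μ x).restrict (π := fun _ => ℝ) := funext fun u => restrict_latentLevels x u
  have hm : Measurable fun v => L⁻¹ * (ENNReal.ofReal (∏ j ∈ contIdx μ x, f j (x j)) *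
      ENNReal.ofReal (slice c μ x v * sliceBox μ x v)) :=
    (((measurable_slice hc x).mul
      (measurable_boxWeight _ _)).ennreal_ofReal.const_mul _).const_mul _
  rw [lintegral_eq_mul_margDensity hc hc0 hf hx] at hL
  rw [Measure.map_map hr hw, hcomp, volume_withDensity_latentDensity]
  simp_rw [prod_latentWeight_mul hf hc0]
  rw [← withDensity_map_eq _ hr hm, map_restrict_cubeMeasure]
  congr 1
  funext v
  -- The product of the `f_j` occurs both in `L` and in the unnormalized density, so it cancels.
  -- Since `L ≠ 0`, the remaining denominator is positive.
  rw [hL] at hL0 ⊢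
  obtain ⟨h1, h2⟩ := mul_ne_zero_iff.1 hL0
  have hpos := ENNReal.ofReal_pos.1 (pos_iff_ne_zero.2 h2)
  rw [latentDensity_eq, ENNReal.ofReal_div_of_pos hpos,
    ENNReal.mul_inv (Or.inl h1) (Or.inl ENNReal.ofReal_ne_top), ← mul_assoc,
    mul_right_comm _ _ (ENNReal.ofReal (∏ j ∈ contIdx μ x, f j (x j))),
    ENNReal.inv_mul_cancel h1 ENNReal.ofReal_ne_top, one_mul, ENNReal.div_eq_inv_mul]

variable [∀ j, IsProbabilityMeasure (μ j)]

theorem ae_pi_lintegral_latentLevels_lt_top (hc : Measurable c)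
    (hint : ∫⁻ u, ENNReal.ofReal (c u) ∂cubeMeasure ι ≠ ∞) :
    ∀ᵐ x ∂Measure.pi μ, ∫⁻ u, ENNReal.ofReal (c (latentLevels μ x u)) ∂cubeMeasure ι < ∞ := by
  have hQ : Measurable fun (u : ι → ℝ) j => quantile (μ j) (u j) :=
    measurable_pi_lambda _ fun j => (measurable_quantile (μ j)).comp (measurable_pi_apply j)
  have hprob : ∀ j, IsProbabilityMeasure (unifMeasure.map (quantile (μ j))) := fun j => by
    rw [map_quantile_unifMeasure]; infer_instance
  have hpi : Measure.pi μ = (cubeMeasure ι).map fun u j => quantile (μ j) (u j) := by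
    rw [cubeMeasure_eq_pi, Measure.pi_map_pi fun j => (measurable_quantile (μ j)).aemeasurable]
    simp_rw [map_quantile_unifMeasure]
  have hm : Measurable fun x => ∫⁻ u, ENNReal.ofReal (c (latentLevels μ x u)) ∂cubeMeasure ι :=
    (hc.comp (measurable_latentLevels μ)).ennreal_ofReal.lintegral_prod_right'
  rw [hpi, ae_map_iff hQ.aemeasurable (measurableSet_lt hm measurable_const)]
  -- With `x` the quantiles of `u`, `latentLevels μ x v` is `u` on the continuous indices and `v`
  -- elsewhere. This index set depends on `u` but has finitely many possible values, so all are
  -- treated at once.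
  filter_upwards [ae_all_iff.2 fun S => ae_lintegral_mix_lt_top hc.ennreal_ofReal hint S,
    ae_cubeMeasure_of_forall_ae fun j => ae_isMatched_quantile (μ j)] with u hu hmatch
  refine lt_of_eq_of_lt ?_ (hu (contIdx μ fun j => quantile (μ j) (u j)))
  refine lintegral_congr fun v => ?_
  congr 2
  funext j
  by_cases h : quantile (μ j) (u j) ∈ jumps (μ j)
  · rw [if_neg (by rw [mem_contIdx]; exact not_not.2 h), latentLevels, latentLevel, if_pos h]
  · rw [if_pos ((mem_contIdx μ).2 h), latentLevels, latentLevel, if_neg h, ← (hmatch j).1 h]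

/-- `Measure.pi μ` has a density with respect to `mixedMeasure μ` whose factors at jumps are
positive masses. It is therefore nonzero wherever the product of the `f_j` over the continuous
indices is, and there the finiteness known for `Measure.pi μ` transfers. -/
theorem ae_mixedMeasure_integrable_slice (hc : Measurable c) (hc0 : ∀ u, 0 ≤ c u)
    (hint : ∫⁻ u, ENNReal.ofReal (c u) ∂cubeMeasure ι ≠ ∞)
    (hμ : ∀ j, IsMixedMarginal (μ j) (f j)) :
    ∀ᵐ x ∂mixedMeasure μ, ENNReal.ofReal (∏ j ∈ contIdx μ x, f j (x j)) ≠ 0 →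
      Integrable (slice c μ x) (cubeMeasure ↥(discIdx μ x)) := by
  classical
  have hk : ∀ j, Measurable fun t =>
      if t ∈ jumps (μ j) then μ j {t} else ENNReal.ofReal (f j t) := fun j => by
    simp_rw [measure_singleton_eq]
    exact Measurable.ite (measurableSet_jumps _)
      ((measurable_cdf _).sub (measurable_leftLim_cdf _)).ennreal_ofReal
      (hμ j).measurable.ennreal_ofReal
  have hprob : ∀ j, IsProbabilityMeasure ((lebCount (μ j)).withDensity fun t =>
      if t ∈ jumps (μ j) then μ j {t} else ENNReal.ofReal (f j t)) := fun j => by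
    convert! (inferInstance : IsProbabilityMeasure (μ j))
    exact (hμ j).eq_withDensity_lebCount.symm
  have hpi : Measure.pi μ = (mixedMeasure μ).withDensity fun x =>
      ∏ j, if x j ∈ jumps (μ j) then μ j {x j} else ENNReal.ofReal (f j (x j)) := by
    have h := pi_withDensity (fun j => lebCount (μ j)) hk
    rw [mixedMeasure, ← h]
    congr 1
    funext j
    convert! (hμ j).eq_withDensity_lebCount
  have h := ae_pi_lintegral_latentLevels_lt_top (μ := μ) hc hint
  have hkpi : Measurable fun x : ι → ℝ =>
      ∏ j, if x j ∈ jumps (μ j) then μ j {x j} else ENNReal.ofReal (f j (x j)) :=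
    Finset.measurable_fun_prod _ fun j _ => (hk j).comp (measurable_pi_apply j)
  rw [hpi, ae_withDensity_iff hkpi] at h
  filter_upwards [h] with x hx hne
  refine integrable_slice hc hc0 (hx (Finset.prod_ne_zero_iff.2 fun j _ => ?_))
  by_cases hj : x j ∈ jumps (μ j)
  · rw [if_pos hj, measure_singleton_eq]
    exact (ENNReal.ofReal_pos.2 (sub_pos.2 ((mem_jumps_iff_leftLim_lt _).1 hj))).ne'
  · rw [if_neg hj]
    rw [ENNReal.ofReal_prod_of_nonneg fun j _ => (hμ j).nonneg _] at hne
    exact Finset.prod_ne_zero_iff.1 hne j ((mem_contIdx μ).2 hj)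

theorem ae_lintegral_eq_likelihood (hc : Measurable c) (hc0 : ∀ u, 0 ≤ c u)
    (hint : ∫⁻ u, ENNReal.ofReal (c u) ∂cubeMeasure ι ≠ ∞)
    (hμ : ∀ j, IsMixedMarginal (μ j) (f j)) :
    ∀ᵐ x ∂mixedMeasure μ,
      ∫⁻ u, (∏ j, ENNReal.ofReal (latentWeight (μ j) (f j) (x j) (u j))) *
        ENNReal.ofReal (c (latentLevels μ x u)) ∂cubeMeasure ι =
      ENNReal.ofReal (likelihood c μ f x) := by
  have hf : ∀ j t, 0 ≤ f j t := fun j => (hμ j).nonneg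
  filter_upwards [ae_mixedMeasure_integrable_slice hc hc0 hint hμ] with x hx
  have hlik : likelihood c μ f x = (∏ j ∈ contIdx μ x, f j (x j)) *
      (margDensity c (contIdx μ x) ((contIdx μ x).restrict (upper μ x)) * condRectDiff c μ x) := by
    rw [likelihood]; ring
  rw [hlik, ENNReal.ofReal_mul (Finset.prod_nonneg fun j _ => hf j _)]
  -- Where this product vanishes the slice may fail to be integrable, but both sides are zero.
  by_cases h0 : ENNReal.ofReal (∏ j ∈ contIdx μ x, f j (x j)) = 0
  · simp_rw [prod_latentWeight_mul hf hc0, h0, zero_mul]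
    simp
  · exact lintegral_eq_mul_margDensity hc hc0 hf (hx h0)

end Likelihood

end MixedCopula

end

/-! ### The joint law, the likelihood and the conditional law of the latent levels. -/

open MixedCopula in
theorem lemma4 {m : ℕ} {Ω : Type*} [MeasurableSpace Ω] (P : Measure Ω) [IsProbabilityMeasure P]
    (C c : (Fin m → ℝ) → ℝ) (hC : MixedCopula.IsCopula C) (hc : MixedCopula.IsCopulaDensity C c)
    (μ : Fin m → Measure ℝ) [∀ j, IsProbabilityMeasure (μ j)] (f : Fin m → ℝ → ℝ)
    (hμ : ∀ j, MixedCopula.IsMixedMarginal (μ j) (f j))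
    (X U : Ω → Fin m → ℝ) (hX : Measurable X) (hU : Measurable U)
    (hUC : ∀ u, P.real {ω | U ω ≤ u} = C u)
    (hXU : ∀ᵐ ω ∂P,
      (∀ j ∈ MixedCopula.contIdx μ (X ω), U ω j = cdf (μ j) (X ω j)) ∧
      ∀ j ∈ MixedCopula.discIdx μ (X ω), X ω j = MixedCopula.quantile (μ j) (U ω j)) :
    -- (i)
    (P.map (fun ω => (X ω, U ω)) = (MixedCopula.quantileMeasure μ).withDensity
        (fun p => ENNReal.ofReal (MixedCopula.jointDensity c μ p.1 p.2)) ∧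
      P.map (fun ω => (X ω, U ω)) = (MixedCopula.mixedJointMeasure μ f).withDensity
        (fun p => ENNReal.ofReal (MixedCopula.jointDensity c μ p.1 p.2))) ∧
    -- (ii)
    P.map X = (MixedCopula.mixedMeasure μ).withDensity
      (fun x => ENNReal.ofReal (MixedCopula.likelihood c μ f x)) ∧
    -- (iii)
    ∀ᵐ x ∂(P.map X),
      (condDistrib U X P x).map (MixedCopula.discIdx μ x).restrict =
        (volume : Measure (↥(MixedCopula.discIdx μ x) → ℝ)).withDensity
          (fun v => ENNReal.ofReal (MixedCopula.latentDensity c μ x v)) := by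
  have hprob : IsProbabilityMeasure (P.map U) := Measure.isProbabilityMeasure_map hU.aemeasurable
  have hUlaw : P.map U = (cubeMeasure (Fin m)).withDensity fun u => ENNReal.ofReal (c u) :=
    hc.eq_withDensity hC fun u => by
      rw [map_measureReal_apply hU measurableSet_Iic]; exact hUC u
  have hint : ∫⁻ u, ENNReal.ofReal (c u) ∂cubeMeasure (Fin m) ≠ ⊤ :=
    ((hasFiniteIntegral_iff_ofReal (Filter.Eventually.of_forall hc.nonneg)).1
      (hc.integrable hC).2).ne
  have hlaw := map_eq_withDensity_quantileMeasure (X := X) (μ := μ) hU hc.measurable hUlaw (by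
    filter_upwards [hXU] with ω hω j
    exact ⟨fun hj => hω.1 j ((mem_contIdx μ).2 hj), fun hj => hω.2 j ((mem_discIdx μ).2 hj)⟩)
  have hlaw' := hlaw.trans (quantileMeasure_withDensity_eq_map hc.measurable hμ)
  have hf : ∀ j t, 0 ≤ f j t := fun j => (hμ j).nonneg
  have hD : Measurable fun p : (Fin m → ℝ) × (Fin m → ℝ) =>
      (∏ j, ENNReal.ofReal (latentWeight (μ j) (f j) (p.1 j) (p.2 j))) *
        ENNReal.ofReal (c (latentLevels μ p.1 p.2)) :=
    (measurable_prod_latentWeight μ fun j => (hμ j).measurable).mul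
      (hc.measurable.comp (measurable_latentLevels μ)).ennreal_ofReal
  have hPX := map_eq_withDensity_lintegral hX hU hD (measurable_latentLevels μ) hlaw'
  -- The law of `X` charges only points where the normalizing integral is nonzero, which forces the
  -- product of the `f_j` to be nonzero there.
  have hslice : ∀ᵐ x ∂P.map X, Integrable (slice c μ x) (cubeMeasure ↥(discIdx μ x)) := by
    rw [hPX, ae_withDensity_iff hD.lintegral_prod_right']
    filter_upwards [ae_mixedMeasure_integrable_slice hc.measurable hc.nonneg hint hμ] with x hx hL
    refine hx fun h0 => hL ?_
    simp only [prod_latentWeight_mul hf hc.nonneg, h0, zero_mul, lintegral_zero]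
  refine ⟨⟨?_, ?_⟩, ?_, ?_⟩
  · rw [quantileMeasure_withDensity_jointDensity, hlaw]
  · rw [mixedJointMeasure_withDensity_jointDensity hμ, hlaw]
  · rw [hPX]
    exact withDensity_congr_ae (ae_lintegral_eq_likelihood hc.measurable hc.nonneg hint hμ)
  · filter_upwards [condDistrib_ae_eq_map_withDensity hX hU hD (measurable_latentLevels μ) hlaw',
      hslice] with x hx hxs
    rw [hx.2.2]
    exact map_restrict_withDensity_eq hc.measurable hc.nonneg hf hxs rfl hx.1
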